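/- Let $q\in(0,1)$. Let $\mathcal A$ be the unital complex algebra of polynomial functions on $SU_q(2)$, generated by $\alpha,\alpha^*,\gamma,\gamma^*$ with relations $$\alpha^*\alpha+\gamma^*\gamma=1,\quad \alpha\alpha^*+q^2\gamma^*\gamma=1,\quad \gamma^*\gamma=\gamma\gamma^*,\quad \alpha\gamma=q\gamma\alpha,\quad \alpha\gamma^*=q\gamma^*\alpha$$ and the adjoints of these, with comultiplication $\Delta(\alpha)=\alpha\otimes\alpha-q\gamma^*\otimes\gamma$, $\Delta(\gamma)=\gamma\otimes\alpha+\alpha^*\otimes\gamma$ (and the adjoint formulas for $\alpha^*$, $\gamma^*$). For a linear functional $\omega$ on $\mathcal A$ put $\partial_\omega(a)=(\iota\otimes\omega)\Delta(a)$ and $a\triangleleft\omega=(\omega\otimes\iota)\Delta(a)$; functionals are multiplied by convolution. Let $k,e,f$ be the functionals with $k(ab)=k(a)k(b)$, $e(ab)=e(a)k^{-1}(b)+k(a)e(b)$, $f(ab)=f(a)k^{-1}(b)+k(a)f(b)$, whose values on the matrix $\begin{pmatrix}\alpha&-q\gamma^*\\ \gamma&\alpha^*\end{pmatrix}$ are $\begin{pmatrix}q^{1/2}&0\\0&q^{-1/2}\end{pmatrix}$,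 $\begin{pmatrix}0&1\\0&0\end{pmatrix}$, $\begin{pmatrix}0&0\\1&0\end{pmatrix}$ respectively. Let $\mathcal A_n=\{a\in\mathcal A:\partial_k(a)=q^{n/2}a\}$ for $n\in\mathbb Z$, let $\mathcal B=\mathcal A_0$ be the coordinate algebra of the standard quantum sphere $S^2_q$, and let $\sigma(b)=b\triangleleft k^2$ be the twist of $\mathcal B$. Let $\Gamma$ be the exterior algebra of Woronowicz's 3D calculus on $SU_q(2)$: the free left $\mathcal A$-module on the ordered products of subsets of $(\omega_1,\omega_0,\omega_{-1})$, with multiplication determined by $\omega_0a=\partial_{k^{-4}}(a)\omega_0$, $\omega_{\pm1}a=\partial_{k^{-2}}(a)\omega_{\pm1}$, $\omega_i^2=0$, $\omega_{-1}\omega_1=-q^2\omega_1\omega_{-1}$, $\omega_0\omega_1=-q^4\omega_1\omega_0$, $\omega_{-1}\omega_0=-q^4\omega_0\omega_{-1}$, and differential determined by the graded Leibniz rule and $$da=\partial_{fk^{-1}}(a)\omega_{-1}+\frac{a-\partial_{k^{-4}}(a)}{1-q^{-2}}\omega_0+\partial_{ek^{-1}}(a)\omega_1,$$ $$d\omega_{-1}=(q^2+q^4)\omega_0\omega_{-1},\quad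 d\omega_0=-\omega_1\omega_{-1},\quad d\omega_1=(q^2+q^4)\omega_1\omega_0.$$ The de Rham complex of $S^2_q$ is $\Gamma^\wedge_{\mathcal B}=\sum_n\Gamma^{\wedge n}_{\mathcal B}\subset\Gamma$, where $\Gamma^{\wedge n}_{\mathcal B}=\mathrm{span}\{b_0\,db_1\cdots db_n : b_i\in\mathcal B\}$. **Theorem.** (i) The map $(a_{0,0},a_{0,1},a_{1,0},a_{1,1})\mapsto a_{0,0}+a_{0,1}\omega_{-1}+a_{1,0}\omega_1+a_{1,1}\omega_1\omega_{-1}$ identifies $\Gamma^\wedge_{\mathcal B}$, with its product and differential, with the graded differential algebra $\mathcal B\oplus(\mathcal A_{-2}\oplus\mathcal A_2)\oplus\mathcal B$ (the summands being the forms of degree $0,1,2$; there are no nonzero forms of higher degree) with multiplication $$(a_{0,0},a_{0,1},a_{1,0},a_{1,1})\wedge(b_{0,0},b_{0,1},b_{1,0},b_{1,1})$$ $$=(a_{0,0}b_{0,0},\ a_{0,0}b_{0,1}+a_{0,1}b_{0,0},\ a_{1,0}b_{0,0}+a_{0,0}b_{1,0},\ a_{0,0}b_{1,1}-a_{0,1}b_{1,0}+q^2a_{1,0}b_{0,1}+a_{1,1}b_{0,0})$$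 and differential $d=\partial+\bar\partial$, where $$\partial(a_{0,0},a_{0,1},a_{1,0},a_{1,1})=(0,0,\partial_e(a_{0,0}),q\partial_e(a_{0,1})),$$ $$\bar\partial(a_{0,0},a_{0,1},a_{1,0},a_{1,1})=(0,\partial_f(a_{0,0}),0,-q\partial_f(a_{1,0})).$$ (ii) There is a unique linear functional $h$ on $\mathcal A$ with $h(1)=1$ and $(\iota\otimes h)\Delta(a)=h(a)1=(h\otimes\iota)\Delta(a)$ for all $a$ (the Haar state). If $\int\omega=h(\omega)$ for $\omega\in\Gamma^{\wedge2}_{\mathcal B}\cong\mathcal B$, then $\int d\omega=0$ for every $\omega\in\Gamma^{\wedge1}_{\mathcal B}$. (iii) The twist $\sigma$ of $\mathcal B$ extends uniquely to an algebra automorphism of $\Gamma^\wedge_{\mathcal B}$ commuting with $d$. This extension, again denoted $\sigma$, preserves degrees, and $$\int\omega\wedge\omega'=(-1)^{\#\omega\,\#\omega'}\int\sigma(\omega')\wedge\omega$$ for all homogeneous $\omega,\omega'\in\Gamma^\wedge_{\mathcal B}$ with $\#\omega+\#\omega'=2$, where $\#$ denotes the degree. -/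

import Mathlib

open scoped TensorProduct

namespace QSphere

/-! ### The Hopf algebra of polynomial functions on `SU_q(2)` -/

/-- The four generators `α`, `α*`, `γ`, `γ*` of the coordinate algebra. -/
inductive Gen
  | a
  | as
  | c
  | cs

noncomputable section

/-- The deformation parameter `q ∈ (0,1)` as a complex number. -/
def qc (q : Set.Ioo (0 : ℝ) 1) : ℂ := ((q : ℝ) : ℂ)

/-- The number `q^{1/2}`. -/
def qh (q : Set.Ioo (0 : ℝ) 1) : ℂ := ((Real.sqrt (q : ℝ) : ℝ) : ℂ)

theorem qh_sq (q : Set.Ioo (0 : ℝ) 1) : qh q * qh q = qc q := by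
  unfold qh qc
  rw [← Complex.ofReal_mul, Real.mul_self_sqrt q.2.1.le]

theorem qc_ne (q : Set.Ioo (0 : ℝ) 1) : qc q ≠ 0 := by
  unfold qc
  exact_mod_cast q.2.1.ne'

theorem qh_ne (q : Set.Ioo (0 : ℝ) 1) : qh q ≠ 0 := by
  intro h
  apply qc_ne q
  rw [← qh_sq, h, zero_mul]

open FreeAlgebra in
/-- The relations of `SU_q(2)` (together with their adjoints). -/
inductive Rel (q : Set.Ioo (0 : ℝ) 1) : FreeAlgebra ℂ Gen → FreeAlgebra ℂ Gen → Prop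
  | r1 : Rel q (ι ℂ Gen.as * ι ℂ Gen.a + ι ℂ Gen.cs * ι ℂ Gen.c) 1
  | r2 : Rel q (ι ℂ Gen.a * ι ℂ Gen.as + (qc q ^ 2) • (ι ℂ Gen.cs * ι ℂ Gen.c)) 1
  | r3 : Rel q (ι ℂ Gen.cs * ι ℂ Gen.c) (ι ℂ Gen.c * ι ℂ Gen.cs)
  | r4 : Rel q (ι ℂ Gen.a * ι ℂ Gen.c) (qc q • (ι ℂ Gen.c * ι ℂ Gen.a))
  | r5 : Rel q (ι ℂ Gen.a * ι ℂ Gen.cs) (qc q • (ι ℂ Gen.cs * ι ℂ Gen.a))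
  | r6 : Rel q (ι ℂ Gen.cs * ι ℂ Gen.as) (qc q • (ι ℂ Gen.as * ι ℂ Gen.cs))
  | r7 : Rel q (ι ℂ Gen.c * ι ℂ Gen.as) (qc q • (ι ℂ Gen.as * ι ℂ Gen.c))

/-- The algebra `𝒜` of polynomial functions on `SU_q(2)`: the universal unital complex algebra on
`α, α*, γ, γ*` with the relations of `SU_q(2)`. -/
def SUq (q : Set.Ioo (0 : ℝ) 1) : Type := RingQuot (Rel q)

instance (q : Set.Ioo (0 : ℝ) 1) : Ring (SUq q) := inferInstanceAs (Ring (RingQuot (Rel q)))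

instance (q : Set.Ioo (0 : ℝ) 1) : Algebra ℂ (SUq q) :=
  inferInstanceAs (Algebra ℂ (RingQuot (Rel q)))

/-- The quotient map from the free algebra. -/
def mk (q : Set.Ioo (0 : ℝ) 1) : FreeAlgebra ℂ Gen →ₐ[ℂ] SUq q := RingQuot.mkAlgHom ℂ (Rel q)

/-- The image of a generator in `𝒜`. -/
def gen (q : Set.Ioo (0 : ℝ) 1) (x : Gen) : SUq q := mk q (FreeAlgebra.ι ℂ x)

variable {q : Set.Ioo (0 : ℝ) 1}

theorem rel_eq {x y : FreeAlgebra ℂ Gen} (h : Rel q x y) :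
    mk q x = mk q y :=
  RingQuot.mkAlgHom_rel ℂ h

theorem as_a : gen q Gen.as * gen q Gen.a = 1 - gen q Gen.c * gen q Gen.cs := by
  have h := rel_eq (Rel.r1 (q := q))
  have h' := rel_eq (Rel.r3 (q := q))
  simp only [map_add, map_mul, map_one] at h h'
  rw [h'] at h
  exact eq_sub_of_add_eq h

theorem a_as : gen q Gen.a * gen q Gen.as = 1 - qc q ^ 2 • (gen q Gen.c * gen q Gen.cs) := by
  have h := rel_eq (Rel.r2 (q := q))
  have h' := rel_eq (Rel.r3 (q := q))
  simp only [map_add, map_mul, map_one, map_smul] at h h'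
  rw [h'] at h
  exact eq_sub_of_add_eq h

theorem cs_c : gen q Gen.cs * gen q Gen.c = gen q Gen.c * gen q Gen.cs := by
  have h' := rel_eq (Rel.r3 (q := q))
  simp only [map_mul] at h'
  exact h'

theorem a_c : gen q Gen.a * gen q Gen.c = qc q • (gen q Gen.c * gen q Gen.a) := by
  have h' := rel_eq (Rel.r4 (q := q))
  simp only [map_mul, map_smul] at h'
  exact h'

theorem a_cs : gen q Gen.a * gen q Gen.cs = qc q • (gen q Gen.cs * gen q Gen.a) := by
  have h' := rel_eq (Rel.r5 (q := q))
  simp only [map_mul, map_smul] at h'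
  exact h'

theorem cs_as : gen q Gen.cs * gen q Gen.as = qc q • (gen q Gen.as * gen q Gen.cs) := by
  have h' := rel_eq (Rel.r6 (q := q))
  simp only [map_mul, map_smul] at h'
  exact h'

theorem c_as : gen q Gen.c * gen q Gen.as = qc q • (gen q Gen.as * gen q Gen.c) := by
  have h' := rel_eq (Rel.r7 (q := q))
  simp only [map_mul, map_smul] at h'
  exact h'

/-- Four elements of an algebra satisfy the relations of `SU_q(2)`. -/
structure Satisfies (q : Set.Ioo (0 : ℝ) 1) {R : Type*} [Ring R] [Algebra ℂ R]
    (a as c cs : R) : Prop where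
  r1 : as * a + cs * c = 1
  r2 : a * as + (qc q ^ 2) • (cs * c) = 1
  r3 : cs * c = c * cs
  r4 : a * c = qc q • (c * a)
  r5 : a * cs = qc q • (cs * a)
  r6 : cs * as = qc q • (as * cs)
  r7 : c * as = qc q • (as * c)

/-- The universal property of `𝒜`. -/
def lift {R : Type*} [Ring R] [Algebra ℂ R] (a as c cs : R) (h : Satisfies q a as c cs) :
    SUq q →ₐ[ℂ] R :=
  RingQuot.liftAlgHom ℂ ⟨FreeAlgebra.lift ℂ
    (fun x => match x with | Gen.a => a | Gen.as => as | Gen.c => c | Gen.cs => cs), by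
      intro x y hxy
      cases hxy <;> simp only [map_add, map_mul, map_one, map_smul, FreeAlgebra.lift_ι_apply]
      · exact h.r1
      · exact h.r2
      · exact h.r3
      · exact h.r4
      · exact h.r5
      · exact h.r6
      · exact h.r7⟩

section
variable {R : Type*} [Ring R] [Algebra ℂ R] (a as c cs : R) (h : Satisfies q a as c cs)

theorem lift_gen (x : Gen) : lift a as c cs h (gen q x) =
    (match x with | Gen.a => a | Gen.as => as | Gen.c => c | Gen.cs => cs) := by
  unfold lift gen mk
  erw [RingQuot.liftAlgHom_mkAlgHom_apply]
  simp

@[simp] theorem lift_a : lift a as c cs h (gen q Gen.a) = a := lift_gen _ _ _ _ _ _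
@[simp] theorem lift_as : lift a as c cs h (gen q Gen.as) = as := lift_gen _ _ _ _ _ _
@[simp] theorem lift_c : lift a as c cs h (gen q Gen.c) = c := lift_gen _ _ _ _ _ _
@[simp] theorem lift_cs : lift a as c cs h (gen q Gen.cs) = cs := lift_gen _ _ _ _ _ _
end

theorem hom_ext {R : Type*} [Ring R] [Algebra ℂ R] {f g : SUq q →ₐ[ℂ] R}
    (h : ∀ x, f (gen q x) = g (gen q x)) : f = g := by
  refine RingQuot.ringQuot_ext' ℂ f g ?_
  apply FreeAlgebra.hom_ext
  funext x
  exact h x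

theorem induct {P : SUq q → Prop} (hc : ∀ z : ℂ, P (algebraMap ℂ _ z)) (hg : ∀ x, P (gen q x))
    (ha : ∀ x y, P x → P y → P (x + y)) (hm : ∀ x y, P x → P y → P (x * y)) (x : SUq q) : P x := by
  obtain ⟨w, rfl⟩ := RingQuot.mkAlgHom_surjective ℂ (Rel q) x
  induction w using FreeAlgebra.induction with
  | grade0 z => exact (AlgHom.commutes (mk q) z).symm ▸ hc z
  | grade1 x => exact hg x
  | mul x y hx hy => rw [map_mul (RingQuot.mkAlgHom ℂ (Rel q))]; exact hm _ _ hx hy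
  | add x y hx hy => rw [map_add (RingQuot.mkAlgHom ℂ (Rel q))]; exact ha _ _ hx hy

theorem comul_sat : Satisfies q
    (gen q Gen.a ⊗ₜ[ℂ] gen q Gen.a - qc q • (gen q Gen.cs ⊗ₜ[ℂ] gen q Gen.c))
    (gen q Gen.as ⊗ₜ[ℂ] gen q Gen.as - qc q • (gen q Gen.c ⊗ₜ[ℂ] gen q Gen.cs))
    (gen q Gen.c ⊗ₜ[ℂ] gen q Gen.a + gen q Gen.as ⊗ₜ[ℂ] gen q Gen.c)
    (gen q Gen.cs ⊗ₜ[ℂ] gen q Gen.as + gen q Gen.a ⊗ₜ[ℂ] gen q Gen.cs) := by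
  constructor <;>
  simp only [add_mul, mul_add, sub_mul, mul_sub, Algebra.TensorProduct.tmul_mul_tmul,
    smul_mul_assoc, mul_smul_comm, as_a, a_as, cs_c, a_c, a_cs, cs_as, c_as,
    TensorProduct.sub_tmul, TensorProduct.tmul_sub, ← TensorProduct.smul_tmul',
    TensorProduct.tmul_smul, Algebra.TensorProduct.one_def] <;>
  module

/-- The comultiplication `Δ(α) = α ⊗ α - q γ* ⊗ γ`, `Δ(γ) = γ ⊗ α + α* ⊗ γ`, and the adjoint
formulas for `α*`, `γ*`. -/
def comulHom (q : Set.Ioo (0 : ℝ) 1) : SUq q →ₐ[ℂ] SUq q ⊗[ℂ] SUq q := lift _ _ _ _ comul_sat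

/-- The counit `ε(α) = ε(α*) = 1`, `ε(γ) = ε(γ*) = 0`. -/
def counitHom (q : Set.Ioo (0 : ℝ) 1) : SUq q →ₐ[ℂ] ℂ :=
  lift 1 1 0 0 (by constructor <;> simp)

instance (q : Set.Ioo (0 : ℝ) 1) : Bialgebra ℂ (SUq q) :=
  Bialgebra.ofAlgHom (comulHom q) (counitHom q)
    (by
      apply hom_ext
      intro x
      cases x <;>
      simp [comulHom, TensorProduct.sub_tmul, TensorProduct.tmul_sub, TensorProduct.add_tmul,
        TensorProduct.tmul_add, ← TensorProduct.smul_tmul'] <;> module)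
    (by
      apply hom_ext
      intro x
      cases x <;>
      simp [comulHom, counitHom])
    (by
      apply hom_ext
      intro x
      cases x <;>
      simp [comulHom, counitHom])


theorem comul_apply (a : SUq q) : Coalgebra.comul (R := ℂ) a = comulHom q a := rfl

/-! ### Functionals on `𝒜` and their actions

The linear functionals on `𝒜` form, under convolution, the algebra of which the quantized enveloping
algebra of `su_2` is a subalgebra. The pairing of its generators with `𝒜` is determined by the
fundamental corepresentation `((α, -qγ*), (γ, α*))`, which is sent to `diag(q^{1/2}, q^{-1/2})` by
`k`, to `((0, 1), (0, 0))` by `e` and to `((0, 0), (1, 0))` by `f = e*`, and by the coproducts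
`k ↦ k ⊗ k`, `e ↦ e ⊗ k⁻¹ + k ⊗ e`, `f ↦ f ⊗ k⁻¹ + k ⊗ f`. -/

/-- The convolution product `φψ = (φ ⊗ ψ)Δ` of functionals. -/
def conv (φ ψ : Module.Dual ℂ (SUq q)) : Module.Dual ℂ (SUq q) :=
  LinearMap.mul' ℂ ℂ ∘ₗ TensorProduct.map φ ψ ∘ₗ Coalgebra.comul

/-- `∂_φ(a) = φ * a = (ι ⊗ φ)Δ(a)`. -/
def leftAct (φ : Module.Dual ℂ (SUq q)) : SUq q →ₗ[ℂ] SUq q :=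
  (TensorProduct.rid ℂ (SUq q)).toLinearMap ∘ₗ φ.lTensor (SUq q) ∘ₗ Coalgebra.comul

/-- `a ◁ φ = a * φ = (φ ⊗ ι)Δ(a)`. -/
def rightAct (φ : Module.Dual ℂ (SUq q)) : SUq q →ₗ[ℂ] SUq q :=
  (TensorProduct.lid ℂ (SUq q)).toLinearMap ∘ₗ φ.rTensor (SUq q) ∘ₗ Coalgebra.comul

/-- The character `k^n`, with `k^n(α) = q^{n/2}`, `k^n(α*) = q^{-n/2}`, `k^n(γ) = k^n(γ*) = 0`. -/
def kHom (q : Set.Ioo (0 : ℝ) 1) (n : ℤ) : SUq q →ₐ[ℂ] ℂ :=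
  lift (qh q ^ n) (qh q ^ (-n)) 0 0 (by
    have := qh_ne q
    have := zpow_ne_zero n this
    constructor <;> simp [this])

/-- The functional `k^n`, for `n ∈ ℤ`. -/
def kPow (q : Set.Ioo (0 : ℝ) 1) (n : ℤ) : Module.Dual ℂ (SUq q) := (kHom q n).toLinearMap

/-- The homomorphism `a ↦ ((k(a), e(a)), (0, k⁻¹(a)))`; it is multiplicative because the coproduct of
`e` is `e ⊗ k⁻¹ + k ⊗ e`. On generators `e(γ*) = -q⁻¹`, `e(α) = e(α*) = e(γ) = 0`. -/
def eHom (q : Set.Ioo (0 : ℝ) 1) : SUq q →ₐ[ℂ] Matrix (Fin 2) (Fin 2) ℂ :=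
  lift !![qh q, 0; 0, (qh q)⁻¹] !![(qh q)⁻¹, 0; 0, qh q] 0 !![0, -(qc q)⁻¹; 0, 0] (by
    have := qh_ne q
    constructor <;> ext i j <;> fin_cases i <;> fin_cases j <;>
      simp [← qh_sq, this] <;> field_simp)

/-- The homomorphism `a ↦ ((k(a), f(a)), (0, k⁻¹(a)))`. On generators `f(γ) = 1`,
`f(α) = f(α*) = f(γ*) = 0`. -/
def fHom (q : Set.Ioo (0 : ℝ) 1) : SUq q →ₐ[ℂ] Matrix (Fin 2) (Fin 2) ℂ :=
  lift !![qh q, 0; 0, (qh q)⁻¹] !![(qh q)⁻¹, 0; 0, qh q] !![0, 1; 0, 0] 0 (by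
    have := qh_ne q
    constructor <;> ext i j <;> fin_cases i <;> fin_cases j <;>
      simp [← qh_sq, this])

/-- The functionals `k^n` are the convolution powers of `k`. -/
theorem kPow_add (m n : ℤ) : conv (kPow q m) (kPow q n) = kPow q (m + n) := by
  have h : ((Algebra.TensorProduct.lmul' ℂ (S := ℂ)).comp
      (Algebra.TensorProduct.map (kHom q m) (kHom q n))).comp (comulHom q) = kHom q (m + n) := by
    apply hom_ext
    intro x
    cases x <;> simp [comulHom, kHom, zpow_add₀ (qh_ne q), mul_comm]
  ext a
  exact DFunLike.congr_fun h a

/-- The functional `e`. -/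
def ePair (q : Set.Ioo (0 : ℝ) 1) : Module.Dual ℂ (SUq q) :=
  Matrix.entryLinearMap ℂ ℂ 0 1 ∘ₗ (eHom q).toLinearMap

/-- The functional `f`. -/
def fPair (q : Set.Ioo (0 : ℝ) 1) : Module.Dual ℂ (SUq q) :=
  Matrix.entryLinearMap ℂ ℂ 0 1 ∘ₗ (fHom q).toLinearMap

/-- The product rule given by the coproduct `φ ↦ φ ⊗ k⁻¹ + k ⊗ φ`. -/
def IsTwistedDer (φ : Module.Dual ℂ (SUq q)) : Prop :=
  ∀ x y, φ (x * y) = φ x * kPow q (-1) y + kPow q 1 x * φ y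

theorem twisted_aux (g : SUq q →ₐ[ℂ] Matrix (Fin 2) (Fin 2) ℂ)
    (hg : ∀ x, g (gen q x) 0 0 = kPow q 1 (gen q x) ∧ g (gen q x) 1 1 = kPow q (-1) (gen q x) ∧
      g (gen q x) 1 0 = 0) (x y : SUq q) :
    g (x * y) 0 1 = g x 0 1 * kPow q (-1) y + kPow q 1 x * g y 0 1 := by
  have key : ∀ x : SUq q, g x 0 0 = kPow q 1 x ∧ g x 1 1 = kPow q (-1) x ∧ g x 1 0 = 0 := by
    intro x
    induction x using induct with
    | hc z => simp [kPow, AlgHom.commutes, Matrix.algebraMap_matrix_apply]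
    | hg x => exact hg x
    | ha x y hx hy => simp [hx.1, hx.2.1, hx.2.2, hy.1, hy.2.1, hy.2.2]
    | hm x y hx hy =>
      simp [Matrix.mul_apply, Fin.sum_univ_two, hx.1, hx.2.1, hx.2.2, hy.1, hy.2.1, hy.2.2]
      simp [kPow]
  rw [map_mul, Matrix.mul_apply, Fin.sum_univ_two, (key x).1, (key y).2.1]
  ring

theorem ePair_mul : IsTwistedDer (ePair q) := by
  intro x y
  refine twisted_aux (eHom q) ?_ x y
  intro x
  cases x <;> simp [eHom, kPow, kHom]

theorem fPair_mul : IsTwistedDer (fPair q) := by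
  intro x y
  refine twisted_aux (fHom q) ?_ x y
  intro x
  cases x <;> simp [fHom, kPow, kHom]

theorem leftAct_leibniz {φ α β ψ : Module.Dual ℂ (SUq q)}
    (h : ∀ x y, φ (x * y) = φ x * α y + β x * ψ y) (x y : SUq q) :
    leftAct φ (x * y) = leftAct φ x * leftAct α y + leftAct β x * leftAct ψ y := by
  have key : ∀ s t : SUq q ⊗[ℂ] SUq q,
      TensorProduct.rid ℂ _ (φ.lTensor _ (s * t)) =
      TensorProduct.rid ℂ _ (φ.lTensor _ s) * TensorProduct.rid ℂ _ (α.lTensor _ t) +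
      TensorProduct.rid ℂ _ (β.lTensor _ s) * TensorProduct.rid ℂ _ (ψ.lTensor _ t) := by
    intro s t
    induction s using TensorProduct.induction_on with
    | zero => simp
    | add s s' hs hs' => simp only [add_mul, map_add, hs, hs']; abel
    | tmul a b =>
      induction t using TensorProduct.induction_on with
      | zero => simp
      | add s s' hs hs' => simp only [mul_add, map_add, hs, hs']; abel
      | tmul c d =>
        simp only [Algebra.TensorProduct.tmul_mul_tmul, LinearMap.lTensor_tmul,
          TensorProduct.rid_tmul, h, smul_mul_smul_comm, add_smul]
  have := key (comulHom q x) (comulHom q y)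
  rw [← map_mul] at this
  exact this

theorem leftAct_kPow_mul (n : ℤ) (x y : SUq q) :
    leftAct (kPow q n) (x * y) = leftAct (kPow q n) x * leftAct (kPow q n) y := by
  have := leftAct_leibniz (φ := kPow q n) (α := kPow q n) (β := kPow q n) (ψ := 0)
    (by intro x y; simp [kPow]) x y
  rw [this]
  simp [leftAct]

theorem rightAct_kPow_mul (n : ℤ) (x y : SUq q) :
    rightAct (kPow q n) (x * y) = rightAct (kPow q n) x * rightAct (kPow q n) y := by
  let F : SUq q →ₐ[ℂ] SUq q := ((Algebra.TensorProduct.lid ℂ (SUq q)).toAlgHom.comp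
      (Algebra.TensorProduct.map (kHom q n) (AlgHom.id ℂ _))).comp (comulHom q)
  have h : ∀ x, rightAct (kPow q n) x = F x := fun x => rfl
  simp only [h, map_mul]

theorem leftAct_algebraMap (φ : Module.Dual ℂ (SUq q)) (z : ℂ) :
    leftAct φ (algebraMap ℂ _ z) = algebraMap ℂ _ (z * φ 1) := by
  simp only [leftAct, LinearMap.comp_apply, comul_apply, AlgHom.commutes,
    Algebra.TensorProduct.algebraMap_apply, LinearMap.lTensor_tmul, LinearEquiv.coe_coe,
    TensorProduct.rid_tmul, Algebra.smul_def, ← map_mul, mul_comm]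

theorem rightAct_algebraMap (φ : Module.Dual ℂ (SUq q)) (z : ℂ) :
    rightAct φ (algebraMap ℂ _ z) = algebraMap ℂ _ (z * φ 1) := by
  rw [Algebra.algebraMap_eq_smul_one, map_smul, Algebra.algebraMap_eq_smul_one]
  simp [rightAct, Algebra.TensorProduct.one_def, Algebra.smul_def]

section gens
variable (φ : Module.Dual ℂ (SUq q))

theorem leftAct_a : leftAct φ (gen q Gen.a) =
    φ (gen q Gen.a) • gen q Gen.a - (qc q * φ (gen q Gen.c)) • gen q Gen.cs := by
  simp [leftAct, comul_apply, comulHom, mul_smul]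

theorem leftAct_as : leftAct φ (gen q Gen.as) =
    φ (gen q Gen.as) • gen q Gen.as - (qc q * φ (gen q Gen.cs)) • gen q Gen.c := by
  simp [leftAct, comul_apply, comulHom, mul_smul]

theorem leftAct_c : leftAct φ (gen q Gen.c) =
    φ (gen q Gen.a) • gen q Gen.c + φ (gen q Gen.c) • gen q Gen.as := by
  simp [leftAct, comul_apply, comulHom]

theorem leftAct_cs : leftAct φ (gen q Gen.cs) =
    φ (gen q Gen.as) • gen q Gen.cs + φ (gen q Gen.cs) • gen q Gen.a := by
  simp [leftAct, comul_apply, comulHom]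

end gens

theorem leftAct_k_comm (n : ℤ) (φ : Module.Dual ℂ (SUq q)) (z : ℂ) (hφ : IsTwistedDer φ)
    (hg : ∀ x, leftAct (kPow q n) (leftAct φ (gen q x)) =
      z • leftAct φ (leftAct (kPow q n) (gen q x)))
    (hk : ∀ x m, leftAct (kPow q n) (leftAct (kPow q m) x) = leftAct (kPow q m) (leftAct (kPow q n) x))
    (a : SUq q) :
    leftAct (kPow q n) (leftAct φ a) = z • leftAct φ (leftAct (kPow q n) a) := by
  have h1 : φ 1 = 0 := by
    have := hφ 1 1
    simpa [kPow] using this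
  induction a using induct with
  | hc w => simp only [leftAct_algebraMap, h1, mul_zero, map_zero, smul_zero]
  | hg x => exact hg x
  | ha x y hx hy => simp [hx, hy]
  | hm x y hx hy =>
    simp only [leftAct_leibniz hφ, leftAct_kPow_mul, map_add, hx, hy, hk, smul_add,
      smul_mul_assoc, mul_smul_comm]

theorem leftAct_kPow_comm (m n : ℤ) (a : SUq q) :
    leftAct (kPow q n) (leftAct (kPow q m) a) = leftAct (kPow q m) (leftAct (kPow q n) a) := by
  induction a using induct with
  | hc z => simp [leftAct_algebraMap, kPow]
  | hg x =>
    cases x <;> simp [leftAct_a, leftAct_as, leftAct_c, leftAct_cs, kPow, kHom, smul_smul, mul_comm]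
  | ha x y hx hy => simp [hx, hy]
  | hm x y hx hy => simp only [leftAct_kPow_mul, hx, hy]

theorem leftAct_k_e (a : SUq q) :
    leftAct (kPow q 1) (leftAct (ePair q) a) = qc q • leftAct (ePair q) (leftAct (kPow q 1) a) := by
  refine leftAct_k_comm 1 _ _ ePair_mul ?_ (fun x m => leftAct_kPow_comm m 1 x) a
  have := qh_ne q
  intro x
  cases x <;> simp [leftAct_a, leftAct_as, leftAct_c, leftAct_cs, kPow, kHom, ePair, eHom,
    smul_smul, ← qh_sq] <;> congr 1 <;> field_simp

theorem leftAct_k_f (a : SUq q) :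
    leftAct (kPow q 1) (leftAct (fPair q) a) =
      (qc q)⁻¹ • leftAct (fPair q) (leftAct (kPow q 1) a) := by
  refine leftAct_k_comm 1 _ _ fPair_mul ?_ (fun x m => leftAct_kPow_comm m 1 x) a
  have := qh_ne q
  intro x
  cases x <;> simp [leftAct_a, leftAct_as, leftAct_c, leftAct_cs, kPow, kHom, fPair, fHom,
    smul_smul, ← qh_sq] <;> congr 1 <;> field_simp

theorem leftAct_rightAct_kPow (m n : ℤ) (a : SUq q) :
    leftAct (kPow q m) (rightAct (kPow q n) a) = rightAct (kPow q n) (leftAct (kPow q m) a) := by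
  induction a using induct with
  | hc z => simp [leftAct_algebraMap, rightAct_algebraMap, kPow]
  | hg x =>
    cases x <;> simp [leftAct_a, leftAct_as, leftAct_c, leftAct_cs, kPow, kHom, smul_smul, mul_comm,
      rightAct, comul_apply, comulHom]
  | ha x y hx hy => simp [hx, hy]
  | hm x y hx hy => simp only [leftAct_kPow_mul, rightAct_kPow_mul, hx, hy]

/-! ### The Haar state, the spaces `𝒜_n` and the twist -/

/-- `h` is the Haar state (on `𝒜`): `h(1) = 1`, `(ι ⊗ h)Δ(a) = h(a)1` and `(h ⊗ ι)Δ(a) = h(a)1`. -/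
structure IsHaarState (h : Module.Dual ℂ (SUq q)) : Prop where
  map_one : h 1 = 1
  left_invariant : ∀ a, leftAct h a = algebraMap ℂ (SUq q) (h a)
  right_invariant : ∀ a, rightAct h a = algebraMap ℂ (SUq q) (h a)

/-- `𝒜_n = {a ∈ 𝒜 | ∂_k(a) = q^{n/2} a}`. In particular `ℬ = 𝒜_0` is the coordinate algebra of the
standard quantum sphere. -/
def A (q : Set.Ioo (0 : ℝ) 1) (n : ℤ) : Submodule ℂ (SUq q) where
  carrier := {a | leftAct (kPow q 1) a = qh q ^ n • a}
  add_mem' {a b} ha hb := by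
    simp only [Set.mem_ofPred_eq] at *
    rw [map_add, ha, hb, smul_add]
  zero_mem' := by simp
  smul_mem' z a ha := by
    simp only [Set.mem_ofPred_eq] at *
    rw [map_smul, ha, smul_comm]

theorem mem_A {n : ℤ} {a : SUq q} : a ∈ A q n ↔ leftAct (kPow q 1) a = qh q ^ n • a := Iff.rfl

theorem one_mem_A : (1 : SUq q) ∈ A q 0 := by
  rw [mem_A, ← map_one (algebraMap ℂ (SUq q)), leftAct_algebraMap]
  simp [kPow]

theorem mul_mem_A {m n p : ℤ} (h : m + n = p) {a b : SUq q} (ha : a ∈ A q m) (hb : b ∈ A q n) :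
    a * b ∈ A q p := by
  rw [mem_A] at *
  rw [leftAct_kPow_mul, ha, hb, smul_mul_smul_comm, ← zpow_add₀ (qh_ne q), h]

theorem e_mem_A {m p : ℤ} (h : m + 2 = p) {a : SUq q} (ha : a ∈ A q m) :
    leftAct (ePair q) a ∈ A q p := by
  rw [mem_A] at *
  rw [leftAct_k_e, ha, map_smul, smul_smul, ← h, zpow_add₀ (qh_ne q), ← qh_sq]
  congr 1
  rw [mul_comm, zpow_two]

theorem f_mem_A {m p : ℤ} (h : m - 2 = p) {a : SUq q} (ha : a ∈ A q m) :
    leftAct (fPair q) a ∈ A q p := by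
  rw [mem_A] at *
  rw [leftAct_k_f, ha, map_smul, smul_smul, ← h, zpow_sub₀ (qh_ne q), ← qh_sq]
  congr 1
  rw [mul_comm, zpow_two]
  rfl

/-- The product `𝒜_m × 𝒜_n → 𝒜_{m+n}`. -/
def mulA {m n p : ℤ} (h : m + n = p) (a : A q m) (b : A q n) : A q p :=
  ⟨(a : SUq q) * b, mul_mem_A h a.2 b.2⟩

/-- `∂_e : 𝒜_m → 𝒜_{m+2}`. -/
def delE {m p : ℤ} (h : m + 2 = p) : A q m →ₗ[ℂ] A q p :=
  (leftAct (ePair q)).restrict (fun _ ha => e_mem_A h ha)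

/-- `∂_f : 𝒜_m → 𝒜_{m-2}`. -/
def delF {m p : ℤ} (h : m - 2 = p) : A q m →ₗ[ℂ] A q p :=
  (leftAct (fPair q)).restrict (fun _ ha => f_mem_A h ha)

/-- The twist `σ(b) = b ◁ ρ` of `ℬ`, where `ρ = k²`. -/
def twist (q : Set.Ioo (0 : ℝ) 1) : A q 0 →ₗ[ℂ] A q 0 :=
  (rightAct (kPow q 2)).restrict (fun a ha => by
    rw [mem_A] at *
    rw [leftAct_rightAct_kPow, ha, map_smul])

/-! ### The explicit complex -/

/-- The space `ℬ ⊕ (𝒜_{-2} ⊕ 𝒜_2) ⊕ ℬ`, with elements `(a₀₀, a₀₁, a₁₀, a₁₁)`. -/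
@[ext]
structure DeRham (q : Set.Ioo (0 : ℝ) 1) where
  a00 : A q 0
  a01 : A q (-2)
  a10 : A q 2
  a11 : A q 0

namespace DeRham

/-- The underlying vector space is the product of the four components. -/
def equivProd (q : Set.Ioo (0 : ℝ) 1) :
    DeRham q ≃ A q 0 × (A q (-2) × A q 2) × A q 0 where
  toFun x := (x.a00, (x.a01, x.a10), x.a11)
  invFun y := ⟨y.1, y.2.1.1, y.2.1.2, y.2.2⟩
  left_inv _ := rfl
  right_inv _ := rfl

instance : AddCommGroup (DeRham q) := (equivProd q).addCommGroup

instance : Module ℂ (DeRham q) := (equivProd q).module ℂ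

@[simp] theorem add_a00 (x y : DeRham q) : (x + y).a00 = x.a00 + y.a00 := rfl
@[simp] theorem add_a01 (x y : DeRham q) : (x + y).a01 = x.a01 + y.a01 := rfl
@[simp] theorem add_a10 (x y : DeRham q) : (x + y).a10 = x.a10 + y.a10 := rfl
@[simp] theorem add_a11 (x y : DeRham q) : (x + y).a11 = x.a11 + y.a11 := rfl
@[simp] theorem zero_a00 : (0 : DeRham q).a00 = 0 := rfl
@[simp] theorem zero_a01 : (0 : DeRham q).a01 = 0 := rfl
@[simp] theorem zero_a10 : (0 : DeRham q).a10 = 0 := rfl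
@[simp] theorem zero_a11 : (0 : DeRham q).a11 = 0 := rfl
@[simp] theorem smul_a00 (z : ℂ) (x : DeRham q) : (z • x).a00 = z • x.a00 := rfl
@[simp] theorem smul_a01 (z : ℂ) (x : DeRham q) : (z • x).a01 = z • x.a01 := rfl
@[simp] theorem smul_a10 (z : ℂ) (x : DeRham q) : (z • x).a10 = z • x.a10 := rfl
@[simp] theorem smul_a11 (z : ℂ) (x : DeRham q) : (z • x).a11 = z • x.a11 := rfl

instance : One (DeRham q) := ⟨⟨⟨1, one_mem_A⟩, 0, 0, 0⟩⟩

/-- The wedge product. -/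
instance : Mul (DeRham q) where
  mul x y :=
    { a00 := mulA (by norm_num) x.a00 y.a00
      a01 := mulA (by norm_num) x.a00 y.a01 + mulA (by norm_num) x.a01 y.a00
      a10 := mulA (by norm_num) x.a10 y.a00 + mulA (by norm_num) x.a00 y.a10
      a11 := mulA (by norm_num) x.a00 y.a11 - mulA (by norm_num) x.a01 y.a10 +
        qc q ^ 2 • mulA (by norm_num) x.a10 y.a01 + mulA (by norm_num) x.a11 y.a00 }

theorem mul_a00 (x y : DeRham q) : (x * y).a00 = mulA (by norm_num) x.a00 y.a00 := rfl
theorem mul_a01 (x y : DeRham q) : (x * y).a01 =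
    mulA (by norm_num) x.a00 y.a01 + mulA (by norm_num) x.a01 y.a00 := rfl
theorem mul_a10 (x y : DeRham q) : (x * y).a10 =
    mulA (by norm_num) x.a10 y.a00 + mulA (by norm_num) x.a00 y.a10 := rfl
theorem mul_a11 (x y : DeRham q) : (x * y).a11 =
    mulA (by norm_num) x.a00 y.a11 - mulA (by norm_num) x.a01 y.a10 +
        qc q ^ 2 • mulA (by norm_num) x.a10 y.a01 + mulA (by norm_num) x.a11 y.a00 := rfl

theorem one_a00 : (1 : DeRham q).a00 = ⟨1, one_mem_A⟩ := rfl
theorem one_a01 : (1 : DeRham q).a01 = 0 := rfl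
theorem one_a10 : (1 : DeRham q).a10 = 0 := rfl
theorem one_a11 : (1 : DeRham q).a11 = 0 := rfl

theorem ext_val {x y : DeRham q} (h0 : (x.a00 : SUq q) = y.a00) (h1 : (x.a01 : SUq q) = y.a01)
    (h2 : (x.a10 : SUq q) = y.a10) (h3 : (x.a11 : SUq q) = y.a11) : x = y :=
  DeRham.ext (Subtype.ext h0) (Subtype.ext h1) (Subtype.ext h2) (Subtype.ext h3)

instance : Ring (DeRham q) :=
  { (inferInstance : AddCommGroup (DeRham q)), (inferInstance : One (DeRham q)),
    (inferInstance : Mul (DeRham q)) with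
    mul_assoc := by
      intro x y z
      apply ext_val <;>
      simp only [mul_a00, mul_a01, mul_a10, mul_a11, mulA, Submodule.coe_add, Submodule.coe_sub,
        Submodule.coe_smul, mul_add, add_mul, mul_sub, sub_mul, mul_assoc, mul_smul_comm,
        smul_mul_assoc, smul_add] <;> abel
    left_distrib := by
      intro x y z
      apply ext_val <;>
      simp only [mul_a00, mul_a01, mul_a10, mul_a11, mulA, Submodule.coe_add, Submodule.coe_sub,
        Submodule.coe_smul, mul_add, smul_add, add_a00, add_a01, add_a10, add_a11] <;> abel
    right_distrib := by
      intro x y z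
      apply ext_val <;>
      simp only [mul_a00, mul_a01, mul_a10, mul_a11, mulA, Submodule.coe_add, Submodule.coe_sub,
        Submodule.coe_smul, add_mul, smul_add, add_a00, add_a01, add_a10, add_a11] <;> abel
    zero_mul := by
      intro x
      apply ext_val <;>
      simp [mul_a00, mul_a01, mul_a10, mul_a11, mulA]
    mul_zero := by
      intro x
      apply ext_val <;>
      simp [mul_a00, mul_a01, mul_a10, mul_a11, mulA]
    one_mul := by
      intro x
      apply ext_val <;>
      simp [mul_a00, mul_a01, mul_a10, mul_a11, mulA, one_a00, one_a01, one_a10, one_a11]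
    mul_one := by
      intro x
      apply ext_val <;>
      simp [mul_a00, mul_a01, mul_a10, mul_a11, mulA, one_a00, one_a01, one_a10, one_a11] }

instance : Algebra ℂ (DeRham q) :=
  Algebra.ofModule
    (by
      intro z x y
      apply ext_val <;>
      simp only [mul_a00, mul_a01, mul_a10, mul_a11, mulA, Submodule.coe_add, Submodule.coe_sub,
        Submodule.coe_smul, smul_a00, smul_a01, smul_a10, smul_a11, smul_mul_assoc] <;> module)
    (by
      intro z x y
      apply ext_val <;>
      simp only [mul_a00, mul_a01, mul_a10, mul_a11, mulA, Submodule.coe_add, Submodule.coe_sub,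
        Submodule.coe_smul, smul_a00, smul_a01, smul_a10, smul_a11, mul_smul_comm] <;> module)

/-- `∂(a₀₀, a₀₁, a₁₀, a₁₁) = (0, 0, ∂_e(a₀₀), q∂_e(a₀₁))`. -/
def del : DeRham q →ₗ[ℂ] DeRham q where
  toFun x := ⟨0, 0, delE (by norm_num) x.a00, qc q • delE (by norm_num) x.a01⟩
  map_add' x y := by
    apply DeRham.ext
    · exact (add_zero _).symm
    · exact (add_zero _).symm
    · exact map_add _ _ _
    · exact (congrArg _ (map_add _ _ _)).trans (smul_add _ _ _)
  map_smul' z x := by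
    apply DeRham.ext
    · exact (smul_zero _).symm
    · exact (smul_zero _).symm
    · exact map_smul _ _ _
    · exact (congrArg _ (map_smul _ _ _)).trans (smul_comm _ _ _)

/-- `∂̄(a₀₀, a₀₁, a₁₀, a₁₁) = (0, ∂_f(a₀₀), 0, -q∂_f(a₁₀))`. -/
def delbar : DeRham q →ₗ[ℂ] DeRham q where
  toFun x := ⟨0, delF (by norm_num) x.a00, 0, -(qc q • delF (by norm_num) x.a10)⟩
  map_add' x y := by
    apply DeRham.ext
    · exact (add_zero _).symm
    · exact map_add _ _ _
    · exact (add_zero _).symm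
    · exact (congrArg (fun t => -(qc q • t)) (map_add _ _ _)).trans
        ((congrArg Neg.neg (smul_add _ _ _)).trans (neg_add _ _))
  map_smul' z x := by
    apply DeRham.ext
    · exact (smul_zero _).symm
    · exact map_smul _ _ _
    · exact (smul_zero _).symm
    · exact (congrArg (fun t => -(qc q • t)) (map_smul _ _ _)).trans
        ((congrArg Neg.neg (smul_comm _ _ _)).trans (smul_neg _ _).symm)

/-- `d = ∂ + ∂̄`. -/
def d : DeRham q →ₗ[ℂ] DeRham q := del + delbar

/-- The homogeneous components: `ℬ`, `𝒜_{-2} ⊕ 𝒜_2` and `ℬ` in degrees `0`, `1`, `2`, and zero in all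
higher degrees. -/
def deg (q : Set.Ioo (0 : ℝ) 1) : ℕ → Submodule ℂ (DeRham q)
  | 0 => { carrier := {x | x.a01 = 0 ∧ x.a10 = 0 ∧ x.a11 = 0}
           add_mem' := by rintro a b ⟨h1, h2, h3⟩ ⟨h4, h5, h6⟩; simp [*]
           zero_mem' := by simp
           smul_mem' := by rintro z b ⟨h1, h2, h3⟩; simp [*] }
  | 1 => { carrier := {x | x.a00 = 0 ∧ x.a11 = 0}
           add_mem' := by rintro a b ⟨h1, h2⟩ ⟨h4, h5⟩; simp [*]
           zero_mem' := by simp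
           smul_mem' := by rintro z b ⟨h1, h2⟩; simp [*] }
  | 2 => { carrier := {x | x.a00 = 0 ∧ x.a01 = 0 ∧ x.a10 = 0}
           add_mem' := by rintro a b ⟨h1, h2, h3⟩ ⟨h4, h5, h6⟩; simp [*]
           zero_mem' := by simp
           smul_mem' := by rintro z b ⟨h1, h2, h3⟩; simp [*] }
  | _ => ⊥

/-- An element of `ℬ` as a form of degree zero. -/
def ofB (b : A q 0) : DeRham q := ⟨b, 0, 0, 0⟩

/-- The integral `∫ω = h(ω)` of a two-form, where the two-forms are identified with `ℬ`. -/
def integral (h : Module.Dual ℂ (SUq q)) (x : DeRham q) : ℂ := h x.a11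

end DeRham

/-! ### The exterior algebra of the three-dimensional calculus on `SU_q(2)`

As a left `𝒜`-module it is free on the ordered products `ω_S` of the left-invariant forms
`ω_1, ω_0, ω_{-1}` (in this order), where `S` runs over the subsets of the index set. The indices
`0, 1, 2 : Fin 3` stand for `ω_1`, `ω_0`, `ω_{-1}` respectively. The product is determined by
`ω_0 a = ∂_{k⁻⁴}(a) ω_0`, `ω_{±1} a = ∂_{k⁻²}(a) ω_{±1}`, `ω_i² = 0`,
`ω_{-1}ω_1 = -q² ω_1ω_{-1}`, `ω_0ω_1 = -q⁴ ω_1ω_0` and `ω_{-1}ω_0 = -q⁴ ω_0ω_{-1}`. -/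

/-- For `s > t` one has `ω_s ω_t = swapCoeff s t • ω_t ω_s`. -/
def swapCoeff (q : Set.Ioo (0 : ℝ) 1) (s t : Fin 3) : ℂ :=
  if t < s then (if s = 2 ∧ t = 0 then -qc q ^ 2 else -qc q ^ 4) else 1

/-- For disjoint `S`, `T` one has `ω_S ω_T = reorder S T • ω_{S ∪ T}`. -/
def reorder (q : Set.Ioo (0 : ℝ) 1) (S T : Finset (Fin 3)) : ℂ :=
  ∏ s ∈ S, ∏ t ∈ T, swapCoeff q s t

/-- `ω_S a = ∂_{k^{-w}}(a) ω_S` with `w = formWeight S`. -/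
def formWeight (S : Finset (Fin 3)) : ℤ := ∑ s ∈ S, if s = 1 then 4 else 2

/-- The exterior algebra; `x S` is the coefficient in `𝒜` of `ω_S` in `x`. -/
def Forms (q : Set.Ioo (0 : ℝ) 1) : Type := Finset (Fin 3) → SUq q

namespace Forms

instance : AddCommGroup (Forms q) := inferInstanceAs (AddCommGroup (Finset (Fin 3) → SUq q))

instance : Module ℂ (Forms q) := inferInstanceAs (Module ℂ (Finset (Fin 3) → SUq q))

/-- The form `a ω_S`. -/
def single (S : Finset (Fin 3)) (a : SUq q) : Forms q := Pi.single S a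

instance : One (Forms q) := ⟨single ∅ 1⟩

instance : Mul (Forms q) where
  mul x y U := ∑ S ∈ U.powerset,
    reorder q S (U \ S) • (x S * leftAct (kPow q (-formWeight S)) (y (U \ S)))

theorem mul_apply (x y : Forms q) (U : Finset (Fin 3)) : (x * y) U = ∑ S ∈ U.powerset,
    reorder q S (U \ S) • (x S * leftAct (kPow q (-formWeight S)) (y (U \ S))) := rfl

theorem add_apply (x y : Forms q) (U : Finset (Fin 3)) : (x + y) U = x U + y U := rfl
theorem smul_apply (z : ℂ) (x : Forms q) (U : Finset (Fin 3)) : (z • x) U = z • x U := rfl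
theorem zero_apply (U : Finset (Fin 3)) : (0 : Forms q) U = 0 := rfl
theorem one_apply (U : Finset (Fin 3)) : (1 : Forms q) U = if U = ∅ then 1 else 0 := by
  change (Pi.single ∅ 1 : Finset (Fin 3) → SUq q) U = _
  rw [Pi.single_apply]

theorem leftAct_kPow_add (m n : ℤ) (a : SUq q) :
    leftAct (kPow q (m + n)) a = leftAct (kPow q m) (leftAct (kPow q n) a) := by
  induction a using induct with
  | hc z => simp [leftAct_algebraMap, kPow]
  | hg x =>
    cases x <;> simp [leftAct_a, leftAct_as, leftAct_c, leftAct_cs, kPow, kHom, smul_smul,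
      mul_comm, zpow_add₀ (qh_ne q)]
  | ha x y hx hy => simp [hx, hy]
  | hm x y hx hy => simp only [leftAct_kPow_mul, hx, hy]

theorem leftAct_kPow_zero (a : SUq q) : leftAct (kPow q 0) a = a := by
  induction a using induct with
  | hc z => simp [leftAct_algebraMap, kPow]
  | hg x => cases x <;> simp [leftAct_a, leftAct_as, leftAct_c, leftAct_cs, kPow, kHom]
  | ha x y hx hy => simp [hx, hy]
  | hm x y hx hy => simp only [leftAct_kPow_mul, hx, hy]

theorem leftAct_kPow_one (n : ℤ) : leftAct (kPow q n) (1 : SUq q) = 1 := by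
  rw [← map_one (algebraMap ℂ (SUq q)), leftAct_algebraMap]
  simp [kPow]

theorem assoc_aux (x y z : Forms q) : x * y * z = x * (y * z) := by
  funext U
  simp only [mul_apply, map_sum, map_smul, leftAct_kPow_mul, Finset.mul_sum, Finset.sum_mul,
    Finset.smul_sum, smul_mul_assoc, mul_smul_comm, smul_smul]
  rw [Finset.sum_sigma', Finset.sum_sigma']
  refine Finset.sum_bij' (fun p _ => ⟨p.2, p.1 \ p.2⟩) (fun p _ => ⟨p.1 ∪ p.2, p.1⟩) ?_ ?_ ?_ ?_ ?_
  · rintro ⟨T, S⟩ h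
    simp only [Finset.mem_sigma, Finset.mem_powerset] at *
    exact ⟨h.2.trans h.1, Finset.sdiff_subset_sdiff h.1 le_rfl⟩
  · rintro ⟨S, R⟩ h
    simp only [Finset.mem_sigma, Finset.mem_powerset] at *
    exact ⟨Finset.union_subset h.1 (h.2.trans Finset.sdiff_subset), Finset.subset_union_left⟩
  · rintro ⟨T, S⟩ h
    simp only [Finset.mem_sigma, Finset.mem_powerset] at *
    simp [Finset.union_sdiff_of_subset h.2]
  · rintro ⟨S, R⟩ h
    simp only [Finset.mem_sigma, Finset.mem_powerset] at *
    have : Disjoint S R := (Finset.subset_sdiff.1 h.2).2.symm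
    simp [Finset.union_sdiff_cancel_left this]
  · rintro ⟨T, S⟩ h
    simp only [Finset.mem_sigma, Finset.mem_powerset] at *
    obtain ⟨hT, hS⟩ := h
    obtain ⟨R, hR, rfl⟩ : ∃ R, Disjoint S R ∧ T = S ∪ R :=
      ⟨T \ S, Finset.disjoint_sdiff, (Finset.union_sdiff_of_subset hS).symm⟩
    obtain ⟨V, hV, rfl⟩ : ∃ V, Disjoint (S ∪ R) V ∧ U = S ∪ R ∪ V :=
      ⟨U \ (S ∪ R), Finset.disjoint_sdiff, (Finset.union_sdiff_of_subset hT).symm⟩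
    have hSV : Disjoint S V := (Finset.disjoint_union_left.1 hV).1
    have hRV : Disjoint R V := (Finset.disjoint_union_left.1 hV).2
    have e1 : (S ∪ R) \ S = R := Finset.union_sdiff_cancel_left hR
    have e2 : (S ∪ R ∪ V) \ (S ∪ R) = V := Finset.union_sdiff_cancel_left hV
    have e3 : (S ∪ R ∪ V) \ S = R ∪ V := by
      rw [Finset.union_assoc]
      exact Finset.union_sdiff_cancel_left (Finset.disjoint_union_right.2 ⟨hR, hSV⟩)
    have e4 : (R ∪ V) \ R = V := Finset.union_sdiff_cancel_left hRV
    simp only [e1, e2, e3, e4]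
    have w : -formWeight (S ∪ R) = -formWeight S + -formWeight R := by
      unfold formWeight
      rw [Finset.sum_union hR]
      ring
    rw [w, leftAct_kPow_add, mul_assoc]
    congr 1
    unfold reorder
    rw [Finset.prod_union hR]
    simp only [Finset.prod_union hRV, Finset.prod_mul_distrib]
    ring

instance : Ring (Forms q) :=
  { (inferInstance : AddCommGroup (Forms q)), (inferInstance : One (Forms q)),
    (inferInstance : Mul (Forms q)) with
    mul_assoc := assoc_aux
    left_distrib := by
      intro x y z
      funext U
      simp only [mul_apply, add_apply, map_add, mul_add, smul_add, Finset.sum_add_distrib]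
    right_distrib := by
      intro x y z
      funext U
      simp only [mul_apply, add_apply, add_mul, smul_add, Finset.sum_add_distrib]
    zero_mul := by
      intro x
      funext U
      simp [mul_apply, zero_apply]
    mul_zero := by
      intro x
      funext U
      simp [mul_apply, zero_apply]
    one_mul := by
      intro x
      funext U
      simp only [mul_apply, one_apply]
      rw [Finset.sum_eq_single ∅]
      · simp [reorder, formWeight, leftAct_kPow_zero]
      · intro S _ hS
        simp [hS]
      · simp
    mul_one := by
      intro x
      funext U
      simp only [mul_apply, one_apply]
      rw [Finset.sum_eq_single U]
      · simp [reorder, leftAct_kPow_one]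
      · intro S hS hne
        have : U \ S ≠ ∅ := by
          intro h
          exact hne (Finset.Subset.antisymm (Finset.mem_powerset.1 hS)
            (Finset.sdiff_eq_empty_iff_subset.1 h))
        simp [this]
      · simp }

instance : Algebra ℂ (Forms q) :=
  Algebra.ofModule
    (by
      intro z x y
      funext U
      simp only [mul_apply, smul_apply, smul_mul_assoc, Finset.smul_sum, smul_comm z])
    (by
      intro z x y
      funext U
      simp only [mul_apply, smul_apply, map_smul, mul_smul_comm, Finset.smul_sum, smul_comm z])

/-- An element of `𝒜` as a form of degree zero. -/
def ofA (a : SUq q) : Forms q := single ∅ a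

/-- The left-invariant one-forms: `omega 0 = ω_1`, `omega 1 = ω_0`, `omega 2 = ω_{-1}`. -/
def omega (q : Set.Ioo (0 : ℝ) 1) (i : Fin 3) : Forms q := single {i} 1

/-- The ordered product `ω_S`. -/
def omegaSet (q : Set.Ioo (0 : ℝ) 1) (S : Finset (Fin 3)) : Forms q := single S 1

theorem single_mul_single (S T : Finset (Fin 3)) (a b : SUq q) :
    single S a * single T b = if Disjoint S T then
      single (S ∪ T) (reorder q S T • (a * leftAct (kPow q (-formWeight S)) b)) else 0 := by
  funext U
  rw [mul_apply]
  have e : ∀ (S : Finset (Fin 3)) (a : SUq q) V, single S a V = if V = S then a else 0 := by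
    intro S a V
    exact Pi.single_apply S a V
  by_cases hST : Disjoint S T
  · rw [if_pos hST, e]
    by_cases hU : U = S ∪ T
    · subst hU
      rw [if_pos rfl, Finset.sum_eq_single S]
      · rw [Finset.union_sdiff_cancel_left hST]
        simp [e]
      · intro V _ hV
        simp [e, hV]
      · intro h
        exact absurd (Finset.mem_powerset.2 Finset.subset_union_left) h
    · rw [if_neg hU]
      apply Finset.sum_eq_zero
      intro V hV
      rw [e, e]
      split_ifs with h1 h2
      · subst h1
        exact absurd (by rw [← h2, Finset.union_sdiff_of_subset (Finset.mem_powerset.1 hV)]) hU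
      · simp
      · simp
      · simp
  · rw [if_neg hST]
    apply Finset.sum_eq_zero
    intro V hV
    rw [e, e]
    split_ifs with h1 h2
    · subst h1
      exact absurd (h2 ▸ Finset.disjoint_sdiff) hST
    · simp
    · simp
    · simp

/-! The rules of the exterior algebra hold. -/

theorem ofA_mul_omega (a : SUq q) (S : Finset (Fin 3)) : ofA a * omegaSet q S = single S a := by
  unfold ofA omegaSet
  rw [single_mul_single, if_pos (Finset.disjoint_empty_left S)]
  simp [reorder, leftAct_kPow_one]

theorem omega_mul_ofA (i : Fin 3) (a : SUq q) : omega q i * ofA a =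
    ofA (leftAct (kPow q (if i = 1 then -4 else -2)) a) * omega q i := by
  have h := ofA_mul_omega (leftAct (kPow q (if i = 1 then -4 else -2)) a) {i}
  unfold omegaSet at h
  unfold omega
  rw [h]
  unfold ofA
  rw [single_mul_single, if_pos (Finset.disjoint_empty_right _)]
  fin_cases i <;> simp [reorder, formWeight]

theorem omega_sq (i : Fin 3) : omega q i * omega q i = 0 := by
  unfold omega
  rw [single_mul_single, if_neg (by simp)]

theorem omega_mul_omega {i j : Fin 3} (h : i < j) :
    omega q i * omega q j = omegaSet q {i, j} ∧
    omega q j * omega q i = swapCoeff q j i • (omega q i * omega q j) := by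
  have hij : i ≠ j := h.ne
  have e1 : omega q i * omega q j = omegaSet q {i, j} := by
    unfold omega omegaSet
    rw [single_mul_single, if_pos (Finset.disjoint_singleton.2 hij), Finset.insert_eq]
    simp only [reorder, leftAct_kPow_one, Finset.prod_singleton, mul_one, swapCoeff, h.not_gt,
      if_false, one_smul]
  refine ⟨e1, ?_⟩
  rw [e1]
  unfold omega omegaSet
  rw [single_mul_single, if_pos (Finset.disjoint_singleton.2 hij.symm)]
  simp only [reorder, leftAct_kPow_one, Finset.prod_singleton, mul_one, Finset.union_comm {j} {i},
    ← Finset.insert_eq]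
  funext U
  rw [smul_apply]
  simp only [single, Pi.single_apply]
  split_ifs <;> simp

/-- The differential of `a ∈ 𝒜`,
`da = ∂_{fk⁻¹}(a) ω_{-1} + (1 - q⁻²)⁻¹ (a - ∂_{k⁻⁴}(a)) ω_0 + ∂_{ek⁻¹}(a) ω_1`. -/
def d0 (a : SUq q) : Forms q :=
  ofA (leftAct (conv (fPair q) (kPow q (-1))) a) * omega q 2 +
  ofA ((1 - (qc q ^ 2)⁻¹)⁻¹ • (a - leftAct (kPow q (-4)) a)) * omega q 1 +
  ofA (leftAct (conv (ePair q) (kPow q (-1))) a) * omega q 0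

/-- The differential of `ω_S`: `dω_{-1} = (q² + q⁴) ω_0ω_{-1}`, `dω_0 = -ω_1ω_{-1}`,
`dω_1 = (q² + q⁴) ω_1ω_0`; by the graded Leibniz rule the products of two or three of the `ω_i` are
closed. -/
def dOmega (q : Set.Ioo (0 : ℝ) 1) (S : Finset (Fin 3)) : Forms q :=
  if S = {2} then (qc q ^ 2 + qc q ^ 4) • (omega q 1 * omega q 2)
  else if S = {1} then -(omega q 0 * omega q 2)
  else if S = {0} then (qc q ^ 2 + qc q ^ 4) • (omega q 0 * omega q 1)
  else 0

/-- The differential, `d(a ω_S) = da ω_S + a dω_S`. -/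
def d (x : Forms q) : Forms q :=
  ∑ S : Finset (Fin 3), (d0 (x S) * omegaSet q S + ofA (x S) * dOmega q S)

/-- The `n`-forms of the standard calculus on the quantum sphere:
the span of `b₀ db₁ ⋯ dbₙ` with all `b_i ∈ ℬ`. -/
def sphereForms (q : Set.Ioo (0 : ℝ) 1) (n : ℕ) : Submodule ℂ (Forms q) :=
  Submodule.span ℂ {w | ∃ b₀ ∈ A q 0, ∃ b : Fin n → SUq q, (∀ i, b i ∈ A q 0) ∧
    w = ofA b₀ * (List.ofFn fun i => d (ofA (b i))).prod}

end Forms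

/-- A graded differential algebra over `ℂ`: a graded algebra `R = ⨁ 𝒢 n` with a differential of degree
one which satisfies `d² = 0` and the graded Leibniz rule. -/
structure IsGradedDifferentialAlgebra {R : Type*} [Ring R] [Algebra ℂ R]
    (𝒢 : ℕ → Submodule ℂ R) (d : R →ₗ[ℂ] R) : Prop where
  isInternal : DirectSum.IsInternal 𝒢
  one_mem : (1 : R) ∈ 𝒢 0
  mul_mem : ∀ m n, ∀ x ∈ 𝒢 m, ∀ y ∈ 𝒢 n, x * y ∈ 𝒢 (m + n)
  d_mem : ∀ n, ∀ x ∈ 𝒢 n, d x ∈ 𝒢 (n + 1)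
  d_d : ∀ x, d (d x) = 0
  leibniz : ∀ n, ∀ x ∈ 𝒢 n, ∀ y, d (x * y) = d x * y + (-1 : ℂ) ^ n • (x * d y)

end
end QSphere

open QSphere

namespace QSphere

noncomputable section

variable {q : Set.Ioo (0 : ℝ) 1}

/-! ### Functionals and their actions -/

/-! Everything rests on weights. On `A q n` every power of `k` acts from the left by a scalar, so
∂_e and ∂_f become skew derivations with scalar twists, and moving an invariant form past a
homogeneous coefficient costs only a power of q.

For (i), the explicit wedge product and differential are what the exterior algebra gives on the
weights 0, -2, 2. The ω_0-part of db vanishes for b of weight 0. In d(aω_{±1}) the ω_0-part of da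
cancels against a dω_{±1} (`d_single_two`, `d_single_zero`). On `ℬ` the commutator [e, f] = (k² -
k⁻²)/(q - q⁻¹) acts as zero, which gives d² = 0. Hence `embed` is an injective homomorphism
commuting with d, and its image has to be identified. Let u be the fundamental corepresentation and
v its inverse. The products u_{i0}u_{j1} lie in `ℬ`, ∂_e turns them into multiples of u_{i0}u_{j0}
and ∂_f into multiples of u_{i1}u_{j1}. Since vu = 1, contracting with two entries of a single row
of v isolates any prescribed coefficient (`sum_fundamentalInv_mul`). So all of degrees 1 and 2 is
spanned by forms b₀ db₁ ⋯ dbₙ (`exactSpan_eq`).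

For (ii), the monomials γ^k(γ*)^l α^i form a basis: they span, and an explicit representation on the
free space over their indices separates them. The functional `haar` is supported on (γγ*)^k, with
values chosen so that (1 - q^{2k+2}) h((γγ*)^k) does not depend on k. Weights and one telescoping
family of monomials show that h kills the images of ∂_e and ∂_f. This makes the integral closed, and
it forces (ι ⊗ h)Δ(a) = h(a)1, since every monomial other than a power of γγ* either has nonzero
weight or lies in one of these images. Transposing the corepresentation turns the left invariant
functional into a right invariant one, and a normalized left invariant functional always equals a
normalized right invariant one.

For (iii), h(ab) = h(θ(b)a) with θ(b) = ∂_{k²}(b ◁ k²). As θ is multiplicative, generators suffice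
(`haar_mul_comm`). On `A q m` the left factor of θ is the scalar q^m, which on one-forms is absorbed
by the q² in the wedge product. The right action of k² is multiplicative and commutes with ∂_e and
∂_f, so it extends the twist; uniqueness holds because the complex is generated by `ℬ` and d`ℬ`. -/

theorem conv_apply_leftAct (φ ψ : Module.Dual ℂ (SUq q)) (a : SUq q) :
    conv φ ψ a = φ (leftAct ψ a) := by
  simp only [conv, leftAct, LinearMap.comp_apply, LinearEquiv.coe_coe]
  generalize (Coalgebra.comul (R := ℂ) a : SUq q ⊗[ℂ] SUq q) = x
  induction x using TensorProduct.induction_on with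
  | zero => simp
  | add x y hx hy => simp only [map_add, hx, hy]
  | tmul a b => simp [mul_comm]

theorem conv_apply_rightAct (φ ψ : Module.Dual ℂ (SUq q)) (a : SUq q) :
    conv φ ψ a = ψ (rightAct φ a) := by
  simp only [conv, rightAct, LinearMap.comp_apply, LinearEquiv.coe_coe]
  generalize (Coalgebra.comul (R := ℂ) a : SUq q ⊗[ℂ] SUq q) = x
  induction x using TensorProduct.induction_on with
  | zero => simp
  | add x y hx hy => simp only [map_add, hx, hy]
  | tmul a b => simp

/-- This is coassociativity. The auxiliary identity holds for every tensor in place of Δ(a);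
coassociativity enters only when it is specialized to Δ(a). -/
theorem leftAct_conv (φ ψ : Module.Dual ℂ (SUq q)) (a : SUq q) :
    leftAct (conv φ ψ) a = leftAct φ (leftAct ψ a) := by
  have key : ∀ x : SUq q ⊗[ℂ] SUq q,
      leftAct φ (TensorProduct.rid ℂ _ (ψ.lTensor _ x)) =
      TensorProduct.rid ℂ _ ((LinearMap.mul' ℂ ℂ ∘ₗ TensorProduct.map φ ψ).lTensor _
        (TensorProduct.assoc ℂ _ _ _ (Coalgebra.comul.rTensor _ x))) := by
    intro x
    induction x using TensorProduct.induction_on with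
    | zero => simp
    | add x y hx hy => simp only [map_add, hx, hy]
    | tmul a b =>
      simp only [LinearMap.lTensor_tmul, TensorProduct.rid_tmul, map_smul, leftAct,
        LinearMap.comp_apply, LinearEquiv.coe_coe, LinearMap.rTensor_tmul]
      generalize (Coalgebra.comul (R := ℂ) a : SUq q ⊗[ℂ] SUq q) = y
      induction y using TensorProduct.induction_on with
      | zero => simp
      | add x y hx hy => simp only [map_add, smul_add, TensorProduct.add_tmul, hx, hy]
      | tmul c d => simp [smul_smul, mul_comm]
  have h := key (Coalgebra.comul a)
  rw [Coalgebra.coassoc_apply, ← LinearMap.lTensor_comp_apply] at h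
  exact h.symm

/-- Both sides are (ψ ⊗ ι ⊗ φ) applied to the iterated comultiplication. This is why the twist, a
right action, commutes with ∂_e and ∂_f and preserves each `A q m`. -/
theorem leftAct_rightAct (φ ψ : Module.Dual ℂ (SUq q)) (a : SUq q) :
    leftAct φ (rightAct ψ a) = rightAct ψ (leftAct φ a) := by
  have key₁ : ∀ x : SUq q ⊗[ℂ] SUq q,
      leftAct φ (TensorProduct.lid ℂ _ (ψ.rTensor _ x)) =
      TensorProduct.lid ℂ _ (ψ.rTensor _ (((TensorProduct.rid ℂ (SUq q)).toLinearMap ∘ₗ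
        φ.lTensor _).lTensor _ (Coalgebra.comul.lTensor _ x))) := by
    intro x
    induction x using TensorProduct.induction_on with
    | zero => simp
    | add x y hx hy => simp only [map_add, hx, hy]
    | tmul a b => simp [leftAct]
  have key₂ : ∀ x : SUq q ⊗[ℂ] SUq q,
      rightAct ψ (TensorProduct.rid ℂ _ (φ.lTensor _ x)) =
      TensorProduct.lid ℂ _ (ψ.rTensor _ (((TensorProduct.rid ℂ (SUq q)).toLinearMap ∘ₗ
        φ.lTensor _).lTensor _ (TensorProduct.assoc ℂ _ _ _ (Coalgebra.comul.rTensor _ x)))) := by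
    intro x
    induction x using TensorProduct.induction_on with
    | zero => simp
    | add x y hx hy => simp only [map_add, hx, hy]
    | tmul a b =>
      simp only [LinearMap.lTensor_tmul, TensorProduct.rid_tmul, map_smul, rightAct,
        LinearMap.comp_apply, LinearEquiv.coe_coe, LinearMap.rTensor_tmul]
      generalize (Coalgebra.comul (R := ℂ) a : SUq q ⊗[ℂ] SUq q) = y
      induction y using TensorProduct.induction_on with
      | zero => simp
      | add x y hx hy => simp only [map_add, smul_add, TensorProduct.add_tmul, hx, hy]
      | tmul c d => simp [smul_smul]
  have h₁ := key₁ (Coalgebra.comul a)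
  have h₂ := key₂ (Coalgebra.comul a)
  rw [Coalgebra.coassoc_apply, ← h₁] at h₂
  exact h₂.symm

section gens
variable (φ : Module.Dual ℂ (SUq q))

theorem rightAct_a : rightAct φ (gen q Gen.a) =
    φ (gen q Gen.a) • gen q Gen.a - (qc q * φ (gen q Gen.cs)) • gen q Gen.c := by
  simp [rightAct, comul_apply, comulHom, mul_smul]

theorem rightAct_as : rightAct φ (gen q Gen.as) =
    φ (gen q Gen.as) • gen q Gen.as - (qc q * φ (gen q Gen.c)) • gen q Gen.cs := by
  simp [rightAct, comul_apply, comulHom, mul_smul]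

theorem rightAct_c : rightAct φ (gen q Gen.c) =
    φ (gen q Gen.c) • gen q Gen.a + φ (gen q Gen.as) • gen q Gen.c := by
  simp [rightAct, comul_apply, comulHom]

theorem rightAct_cs : rightAct φ (gen q Gen.cs) =
    φ (gen q Gen.cs) • gen q Gen.as + φ (gen q Gen.a) • gen q Gen.cs := by
  simp [rightAct, comul_apply, comulHom]

end gens

theorem rightAct_kPow_one (n : ℤ) : rightAct (kPow q n) (1 : SUq q) = 1 := by
  rw [← map_one (algebraMap ℂ (SUq q)), rightAct_algebraMap]
  simp [kPow]

theorem rightAct_kPow_add (m n : ℤ) (a : SUq q) :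
    rightAct (kPow q (m + n)) a = rightAct (kPow q m) (rightAct (kPow q n) a) := by
  induction a using induct with
  | hc z => simp [rightAct_algebraMap, kPow]
  | hg x =>
    cases x <;> simp [rightAct_a, rightAct_as, rightAct_c, rightAct_cs, kPow, kHom, smul_smul,
      mul_comm, zpow_add₀ (qh_ne q)]
  | ha x y hx hy => simp [hx, hy]
  | hm x y hx hy => simp only [rightAct_kPow_mul, hx, hy]

theorem rightAct_kPow_zero (a : SUq q) : rightAct (kPow q 0) a = a := by
  induction a using induct with
  | hc z => simp [rightAct_algebraMap, kPow]
  | hg x => cases x <;> simp [rightAct_a, rightAct_as, rightAct_c, rightAct_cs, kPow, kHom]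
  | ha x y hx hy => simp [hx, hy]
  | hm x y hx hy => simp only [rightAct_kPow_mul, hx, hy]

/-- Membership only prescribes the action of `k` itself. Positive powers follow by iteration,
negative ones by inverting. -/
theorem leftAct_kPow_of_mem {m : ℤ} {a : SUq q} (ha : a ∈ A q m) (n : ℤ) :
    leftAct (kPow q n) a = qh q ^ (n * m) • a := by
  have h1 : ∀ n : ℕ, leftAct (kPow q n) a = qh q ^ (n * m) • a := by
    intro n
    induction n with
    | zero => simp [Forms.leftAct_kPow_zero]
    | succ n ih =>
      rw [Nat.cast_succ, Forms.leftAct_kPow_add, mem_A.1 ha, map_smul, ih, smul_smul,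
        ← zpow_add₀ (qh_ne q)]
      congr 2
      ring
  obtain ⟨k, rfl | rfl⟩ := n.eq_nat_or_neg
  · exact h1 k
  · have h := congrArg (leftAct (kPow q (-k))) (h1 k)
    rw [← Forms.leftAct_kPow_add, neg_add_cancel, Forms.leftAct_kPow_zero, map_smul] at h
    rw [h, smul_smul, ← zpow_add₀ (qh_ne q)]
    simp [h.symm]

theorem rightAct_mem_A (φ : Module.Dual ℂ (SUq q)) {m : ℤ} {a : SUq q} (ha : a ∈ A q m) :
    rightAct φ a ∈ A q m := by
  rw [mem_A] at *
  rw [leftAct_rightAct, ha, map_smul]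

/-! ### Powers of `q` and `q^{1/2}` -/

theorem qh_pow_four (q : Set.Ioo (0 : ℝ) 1) : qh q ^ 4 = qc q ^ 2 := by
  rw [← qh_sq]; ring

theorem qc_pow_ne_one (q : Set.Ioo (0 : ℝ) 1) {n : ℕ} (hn : n ≠ 0) : qc q ^ n ≠ 1 := by
  have := (pow_lt_one₀ q.2.1.le q.2.2 hn).ne
  unfold qc
  exact_mod_cast this

theorem qh_zpow_ne_one (q : Set.Ioo (0 : ℝ) 1) {n : ℤ} (hn : n ≠ 0) : qh q ^ n ≠ 1 := by
  have h : ∀ n : ℕ, n ≠ 0 → qh q ^ n ≠ 1 := by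
    intro n hn h
    apply qc_pow_ne_one q hn
    rw [← qh_sq, mul_pow, h, one_mul]
  obtain ⟨k, rfl | rfl⟩ := n.eq_nat_or_neg
  · rw [zpow_natCast]
    exact h k (by simpa using hn)
  · rw [zpow_neg, zpow_natCast, Ne, inv_eq_one]
    exact h k (by simpa using hn)

/-! The values of `∂_e` and `∂_f` on generators and products. -/

theorem leftAct_kPow_a (n : ℤ) : leftAct (kPow q n) (gen q Gen.a) = qh q ^ n • gen q Gen.a := by
  simp [leftAct_a, kPow, kHom]

theorem leftAct_kPow_as (n : ℤ) :
    leftAct (kPow q n) (gen q Gen.as) = qh q ^ (-n) • gen q Gen.as := by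
  simp [leftAct_as, kPow, kHom]

theorem leftAct_kPow_c (n : ℤ) : leftAct (kPow q n) (gen q Gen.c) = qh q ^ n • gen q Gen.c := by
  simp [leftAct_c, kPow, kHom]

theorem leftAct_kPow_cs (n : ℤ) :
    leftAct (kPow q n) (gen q Gen.cs) = qh q ^ (-n) • gen q Gen.cs := by
  simp [leftAct_cs, kPow, kHom]

theorem rightAct_kPow_a (n : ℤ) : rightAct (kPow q n) (gen q Gen.a) = qh q ^ n • gen q Gen.a := by
  simp [rightAct_a, kPow, kHom]

theorem rightAct_kPow_as (n : ℤ) :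
    rightAct (kPow q n) (gen q Gen.as) = qh q ^ (-n) • gen q Gen.as := by
  simp [rightAct_as, kPow, kHom]

theorem rightAct_kPow_c (n : ℤ) :
    rightAct (kPow q n) (gen q Gen.c) = qh q ^ (-n) • gen q Gen.c := by
  simp [rightAct_c, kPow, kHom]

theorem rightAct_kPow_cs (n : ℤ) :
    rightAct (kPow q n) (gen q Gen.cs) = qh q ^ n • gen q Gen.cs := by
  simp [rightAct_cs, kPow, kHom]

theorem a_mem_A : gen q Gen.a ∈ A q 1 := leftAct_kPow_a 1
theorem as_mem_A : gen q Gen.as ∈ A q (-1) := leftAct_kPow_as 1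
theorem c_mem_A : gen q Gen.c ∈ A q 1 := leftAct_kPow_c 1
theorem cs_mem_A : gen q Gen.cs ∈ A q (-1) := leftAct_kPow_cs 1

theorem leftAct_e_a : leftAct (ePair q) (gen q Gen.a) = 0 := by
  simp [leftAct_a, ePair, eHom]
theorem leftAct_e_c : leftAct (ePair q) (gen q Gen.c) = 0 := by
  simp [leftAct_c, ePair, eHom]
theorem leftAct_e_as : leftAct (ePair q) (gen q Gen.as) = gen q Gen.c := by
  simp [leftAct_as, ePair, eHom, qc_ne]
theorem leftAct_e_cs : leftAct (ePair q) (gen q Gen.cs) = -((qc q)⁻¹ • gen q Gen.a) := by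
  simp [leftAct_cs, ePair, eHom]
theorem leftAct_f_as : leftAct (fPair q) (gen q Gen.as) = 0 := by
  simp [leftAct_as, fPair, fHom]
theorem leftAct_f_cs : leftAct (fPair q) (gen q Gen.cs) = 0 := by
  simp [leftAct_cs, fPair, fHom]
theorem leftAct_f_a : leftAct (fPair q) (gen q Gen.a) = -(qc q • gen q Gen.cs) := by
  simp [leftAct_a, fPair, fHom]
theorem leftAct_f_c : leftAct (fPair q) (gen q Gen.c) = gen q Gen.as := by
  simp [leftAct_c, fPair, fHom]

theorem leftAct_e_mul (x y : SUq q) : leftAct (ePair q) (x * y) =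
    leftAct (ePair q) x * leftAct (kPow q (-1)) y + leftAct (kPow q 1) x * leftAct (ePair q) y :=
  leftAct_leibniz ePair_mul x y

theorem leftAct_f_mul (x y : SUq q) : leftAct (fPair q) (x * y) =
    leftAct (fPair q) x * leftAct (kPow q (-1)) y + leftAct (kPow q 1) x * leftAct (fPair q) y :=
  leftAct_leibniz fPair_mul x y

theorem leftAct_twisted_mul {φ : Module.Dual ℂ (SUq q)} (hφ : IsTwistedDer φ) {m n : ℤ}
    {x y : SUq q} (hx : x ∈ A q m) (hy : y ∈ A q n) :
    leftAct φ (x * y) =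
      qh q ^ (-n) • (leftAct φ x * y) + qh q ^ m • (x * leftAct φ y) := by
  rw [leftAct_leibniz hφ, leftAct_kPow_of_mem hx, leftAct_kPow_of_mem hy]
  simp

theorem leftAct_twisted_algebraMap {φ : Module.Dual ℂ (SUq q)} (hφ : IsTwistedDer φ) (z : ℂ) :
    leftAct φ (algebraMap ℂ (SUq q) z) = 0 := by
  have h1 : φ 1 = 0 := by simpa [kPow] using hφ 1 1
  rw [leftAct_algebraMap, h1, mul_zero, map_zero]

theorem leftAct_kPow_neg_one_e (a : SUq q) : leftAct (kPow q (-1)) (leftAct (ePair q) a) =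
    (qc q)⁻¹ • leftAct (ePair q) (leftAct (kPow q (-1)) a) := by
  have h := leftAct_k_e (leftAct (kPow q (-1)) a)
  rw [← Forms.leftAct_kPow_add, add_neg_cancel, Forms.leftAct_kPow_zero] at h
  have h2 := congrArg (leftAct (kPow q (-1))) h
  rw [← Forms.leftAct_kPow_add, neg_add_cancel, Forms.leftAct_kPow_zero, map_smul] at h2
  rw [h2, smul_smul, inv_mul_cancel₀ (qc_ne q), one_smul]

theorem leftAct_kPow_neg_one_f (a : SUq q) : leftAct (kPow q (-1)) (leftAct (fPair q) a) =
    qc q • leftAct (fPair q) (leftAct (kPow q (-1)) a) := by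
  have h := leftAct_k_f (leftAct (kPow q (-1)) a)
  rw [← Forms.leftAct_kPow_add, add_neg_cancel, Forms.leftAct_kPow_zero] at h
  have h2 := congrArg (leftAct (kPow q (-1))) h
  rw [← Forms.leftAct_kPow_add, neg_add_cancel, Forms.leftAct_kPow_zero, map_smul] at h2
  rw [h2, smul_smul, mul_inv_cancel₀ (qc_ne q), one_smul]

/-- The relation `[e, f] = (k² - k⁻²)/(q - q⁻¹)`. -/
theorem leftAct_e_f_commutator (a : SUq q) :
    (qc q - (qc q)⁻¹) • (leftAct (ePair q) (leftAct (fPair q) a) -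
      leftAct (fPair q) (leftAct (ePair q) a)) =
    leftAct (kPow q 2) a - leftAct (kPow q (-2)) a := by
  have h0 := qc_ne q
  induction a using induct with
  | hc z =>
    rw [leftAct_twisted_algebraMap ePair_mul, leftAct_twisted_algebraMap fPair_mul]
    simp [leftAct_algebraMap, kPow]
  | hg x =>
    have h2 : qh q ^ (2 : ℤ) = qc q := by rw [zpow_two, qh_sq]
    have h3 : qh q ^ (-2 : ℤ) = (qc q)⁻¹ := by rw [zpow_neg, h2]
    cases x <;> simp only [leftAct_e_a, leftAct_e_as, leftAct_e_c, leftAct_e_cs, leftAct_f_a,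
      leftAct_f_as, leftAct_f_c, leftAct_f_cs, leftAct_kPow_a, leftAct_kPow_as, leftAct_kPow_c,
      leftAct_kPow_cs, map_neg, map_smul, map_zero, h2, h3, neg_neg, smul_neg, smul_smul] <;>
      match_scalars <;> field_simp <;> ring
  | ha x y hx hy =>
    simp only [map_add]
    rw [add_sub_add_comm, smul_add, hx, hy]
    abel
  -- After commuting `k` past `e` and `f`, the mixed terms in ∂_e∂_f(xy) and ∂_f∂_e(xy) cancel. What
  -- remains is the commutator on x times ∂_{k⁻²}(y), plus ∂_{k²}(x) times the commutator on y, and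
  -- this telescopes.
  | hm x y hx hy =>
    have e1 := leftAct_k_e x
    have e2 := leftAct_k_f x
    have e3 := leftAct_kPow_neg_one_e y
    have e4 := leftAct_kPow_neg_one_f y
    have k1 : ∀ x : SUq q, leftAct (kPow q 1) (leftAct (kPow q 1) x) = leftAct (kPow q 2) x := by
      intro x
      rw [← Forms.leftAct_kPow_add]; rfl
    have k2 : ∀ x : SUq q,
        leftAct (kPow q (-1)) (leftAct (kPow q (-1)) x) = leftAct (kPow q (-2)) x := by
      intro x
      rw [← Forms.leftAct_kPow_add]; rfl
    simp only [leftAct_e_mul, leftAct_f_mul, map_add, e1, e2, e3, e4, k1, k2, leftAct_kPow_mul]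
    have hx' : (qc q - (qc q)⁻¹) • (leftAct (ePair q) (leftAct (fPair q) x)) =
      (qc q - (qc q)⁻¹) • leftAct (fPair q) (leftAct (ePair q) x) +
        (leftAct (kPow q 2) x - leftAct (kPow q (-2)) x) := by
      rw [← hx, smul_sub]; abel
    have hy' : (qc q - (qc q)⁻¹) • (leftAct (ePair q) (leftAct (fPair q) y)) =
      (qc q - (qc q)⁻¹) • leftAct (fPair q) (leftAct (ePair q) y) +
        (leftAct (kPow q 2) y - leftAct (kPow q (-2)) y) := by
      rw [← hy, smul_sub]; abel
    simp only [smul_sub, smul_add, ← smul_mul_assoc, ← mul_smul_comm (qc q - (qc q)⁻¹) (leftAct (kPow q 2) x), hx', hy']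
    simp only [mul_add, add_mul, mul_sub, sub_mul, smul_mul_assoc, mul_smul_comm]
    module

/-! ### The transposition -/

theorem transpose_sat : Satisfies q (gen q Gen.a) (gen q Gen.as) (-(qc q • gen q Gen.cs))
    (-((qc q)⁻¹ • gen q Gen.c)) := by
  have := qc_ne q
  constructor <;>
    simp only [neg_mul, mul_neg, smul_mul_assoc, mul_smul_comm,
      as_a, a_as, cs_c, a_c, a_cs, cs_as, c_as] <;> match_scalars <;> field_simp <;> ring

/-- The automorphism of `𝒜` which transposes the fundamental corepresentation; it reverses the
comultiplication. -/
def transpose (q : Set.Ioo (0 : ℝ) 1) : SUq q →ₐ[ℂ] SUq q := lift _ _ _ _ transpose_sat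

theorem transpose_transpose (a : SUq q) : transpose q (transpose q a) = a := by
  have : (transpose q).comp (transpose q) = AlgHom.id ℂ _ := by
    apply hom_ext
    intro x
    cases x <;> simp [transpose, smul_smul, qc_ne]
  exact DFunLike.congr_fun this a

theorem comulHom_transpose (a : SUq q) : comulHom q (transpose q a) =
    Algebra.TensorProduct.comm ℂ _ _
      (Algebra.TensorProduct.map (transpose q) (transpose q) (comulHom q a)) := by
  have : (comulHom q).comp (transpose q) =
      ((Algebra.TensorProduct.comm ℂ (SUq q) (SUq q)).toAlgHom.comp
        (Algebra.TensorProduct.map (transpose q) (transpose q))).comp (comulHom q) := by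
    apply hom_ext
    intro x
    have := qc_ne q
    cases x <;> simp [transpose, comulHom, TensorProduct.neg_tmul, TensorProduct.tmul_neg,
      TensorProduct.tmul_smul, ← TensorProduct.smul_tmul', smul_smul, this]
  exact DFunLike.congr_fun this a

/-- Transposition flips the legs of Δ and so exchanges the two actions. It converts left invariance
of the Haar functional into right invariance without a second computation. -/
theorem transpose_rightAct (φ : Module.Dual ℂ (SUq q)) (a : SUq q) :
    transpose q (rightAct (φ ∘ₗ (transpose q).toLinearMap) a) = leftAct φ (transpose q a) := by
  simp only [rightAct, leftAct, LinearMap.comp_apply, LinearEquiv.coe_coe, comul_apply,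
    comulHom_transpose]
  generalize comulHom q a = x
  induction x using TensorProduct.induction_on with
  | zero => simp
  | add x y hx hy => simp only [map_add, hx, hy]
  | tmul a b => simp

/-! ### Ordered monomials -/

/-- `α^i` for `i ≥ 0` and `(α*)^{-i}` for `i < 0`. -/
def alphaPow (q : Set.Ioo (0 : ℝ) 1) : ℤ → SUq q
  | Int.ofNat n => gen q Gen.a ^ n
  | Int.negSucc n => gen q Gen.as ^ (n + 1)

theorem alphaPow_natCast (n : ℕ) : alphaPow q n = gen q Gen.a ^ n := rfl

theorem alphaPow_neg_natCast (n : ℕ) : alphaPow q (-n) = gen q Gen.as ^ n := by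
  cases n with
  | zero => simp [alphaPow]
  | succ n => rfl

/-- The coefficient of `γγ*` in `-αα*`, occurring in the products `α (α*)^{-i}`. -/
def raiseCoeff (q : Set.Ioo (0 : ℝ) 1) (i : ℤ) : ℂ := if i < 0 then qc q ^ 2 else 0

/-- The coefficient of `γγ*` in `-α*α`, occurring in the products `α* α^i`. -/
def lowerCoeff (i : ℤ) : ℂ := if 0 < i then 1 else 0

theorem a_mul_alphaPow (i : ℤ) : gen q Gen.a * alphaPow q i =
    alphaPow q (i + 1) -
      raiseCoeff q i • (gen q Gen.c * gen q Gen.cs * alphaPow q (i + 1)) := by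
  unfold raiseCoeff
  split_ifs with h
  · obtain ⟨n, rfl⟩ : ∃ n : ℕ, i = -((n + 1 : ℕ) : ℤ) := ⟨(-i - 1).toNat, by omega⟩
    rw [show -((n + 1 : ℕ) : ℤ) + 1 = -(n : ℤ) by push_cast; ring, alphaPow_neg_natCast,
      alphaPow_neg_natCast, pow_succ', ← mul_assoc, a_as, sub_mul, one_mul, smul_mul_assoc]
  · obtain ⟨n, rfl⟩ : ∃ n : ℕ, i = n := ⟨i.toNat, by omega⟩
    rw [← Nat.cast_succ, alphaPow_natCast, alphaPow_natCast, pow_succ', zero_smul, sub_zero]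

theorem as_mul_alphaPow (i : ℤ) : gen q Gen.as * alphaPow q i =
    alphaPow q (i - 1) -
      lowerCoeff i • (gen q Gen.c * gen q Gen.cs * alphaPow q (i - 1)) := by
  unfold lowerCoeff
  split_ifs with h
  · obtain ⟨n, rfl⟩ : ∃ n : ℕ, i = ((n + 1 : ℕ) : ℤ) := ⟨(i - 1).toNat, by omega⟩
    rw [show ((n + 1 : ℕ) : ℤ) - 1 = (n : ℤ) by push_cast; ring, alphaPow_natCast,
      alphaPow_natCast, pow_succ', ← mul_assoc, as_a, sub_mul, one_mul, one_smul]
  · obtain ⟨n, rfl⟩ : ∃ n : ℕ, i = -(n : ℤ) := ⟨(-i).toNat, by omega⟩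
    rw [show -(n : ℤ) - 1 = -((n + 1 : ℕ) : ℤ) by push_cast; ring, alphaPow_neg_natCast,
      alphaPow_neg_natCast, pow_succ', zero_smul, sub_zero]

theorem mul_pow_of_smul_comm {R : Type*} [Ring R] [Algebra ℂ R] {x y : R} {z : ℂ}
    (h : x * y = z • (y * x)) (n : ℕ) : x * y ^ n = z ^ n • (y ^ n * x) := by
  induction n with
  | zero => simp
  | succ n ih =>
    rw [pow_succ, ← mul_assoc, ih, smul_mul_assoc, mul_assoc, h, mul_smul_comm, smul_smul,
      mul_assoc, pow_succ]

theorem as_c : gen q Gen.as * gen q Gen.c = (qc q)⁻¹ • (gen q Gen.c * gen q Gen.as) := by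
  rw [c_as, smul_smul, inv_mul_cancel₀ (qc_ne q), one_smul]

theorem as_cs : gen q Gen.as * gen q Gen.cs = (qc q)⁻¹ • (gen q Gen.cs * gen q Gen.as) := by
  rw [cs_as, smul_smul, inv_mul_cancel₀ (qc_ne q), one_smul]

theorem commute_c_cs : Commute (gen q Gen.c) (gen q Gen.cs) := cs_c.symm

/-- The ordered monomial `γ^k (γ*)^l α^i`. -/
def mono (q : Set.Ioo (0 : ℝ) 1) (i : ℤ) (k l : ℕ) : SUq q :=
  gen q Gen.c ^ k * gen q Gen.cs ^ l * alphaPow q i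

theorem c_mul_mono (i : ℤ) (k l : ℕ) : gen q Gen.c * mono q i k l = mono q i (k + 1) l := by
  unfold mono
  rw [pow_succ', mul_assoc, mul_assoc, mul_assoc]

theorem cs_mul_mono (i : ℤ) (k l : ℕ) : gen q Gen.cs * mono q i k l = mono q i k (l + 1) := by
  unfold mono
  rw [← mul_assoc, ← mul_assoc, ← (commute_c_cs.pow_left k).eq, mul_assoc (_ ^ k), ← pow_succ']

/-- Both α and α* commute with γ and with γ* up to the same scalar, q for α and q⁻¹ for α*, so only
the total exponent k + l matters. -/
theorem mul_c_cs_pow_mul {x y : SUq q} {z : ℂ} (hc : x * gen q Gen.c = z • (gen q Gen.c * x))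
    (hcs : x * gen q Gen.cs = z • (gen q Gen.cs * x)) (k l : ℕ) :
    x * (gen q Gen.c ^ k * gen q Gen.cs ^ l * y) =
      z ^ (k + l) • (gen q Gen.c ^ k * gen q Gen.cs ^ l * (x * y)) := by
  rw [← mul_assoc, ← mul_assoc, mul_pow_of_smul_comm hc, smul_mul_assoc, smul_mul_assoc,
    mul_assoc _ x, mul_pow_of_smul_comm hcs, mul_smul_comm, smul_mul_assoc, smul_smul, pow_add]
  simp only [mul_assoc]

theorem mono_succ_succ (i : ℤ) (k l : ℕ) : mono q i (k + 1) (l + 1) =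
    gen q Gen.c ^ k * gen q Gen.cs ^ l * (gen q Gen.c * gen q Gen.cs * alphaPow q i) := by
  unfold mono
  rw [pow_succ, pow_succ]
  have := (commute_c_cs (q := q).pow_right l).eq
  simp only [mul_assoc]
  rw [← mul_assoc (gen q Gen.c) (_ ^ l), this]
  simp only [mul_assoc]

theorem a_mul_mono (i : ℤ) (k l : ℕ) : gen q Gen.a * mono q i k l =
    qc q ^ (k + l) • (mono q (i + 1) k l - raiseCoeff q i • mono q (i + 1) (k + 1) (l + 1)) := by
  rw [mono_succ_succ]
  unfold mono
  rw [mul_c_cs_pow_mul a_c a_cs, a_mul_alphaPow, mul_sub, mul_smul_comm]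

theorem as_mul_mono (i : ℤ) (k l : ℕ) : gen q Gen.as * mono q i k l =
    (qc q)⁻¹ ^ (k + l) •
      (mono q (i - 1) k l - lowerCoeff i • mono q (i - 1) (k + 1) (l + 1)) := by
  rw [mono_succ_succ]
  unfold mono
  rw [mul_c_cs_pow_mul as_c as_cs, as_mul_alphaPow, mul_sub, mul_smul_comm]

/-! ### The representation on the span of the monomials -/

/-- The vector space with the ordered monomials as a basis. -/
abbrev MonoSpace : Type := (ℤ × ℕ × ℕ) →₀ ℂ

/-- The basis vector of `γ^k (γ*)^l α^i`. -/
def monoVec (i : ℤ) (k l : ℕ) : MonoSpace := Finsupp.single (i, k, l) 1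

/-- The linear map with given values on the basis of monomials. -/
def monoLift {M : Type*} [AddCommGroup M] [Module ℂ M] (f : ℤ → ℕ → ℕ → M) : MonoSpace →ₗ[ℂ] M :=
  Finsupp.linearCombination ℂ fun p => f p.1 p.2.1 p.2.2

@[simp] theorem monoLift_monoVec {M : Type*} [AddCommGroup M] [Module ℂ M]
    (f : ℤ → ℕ → ℕ → M) (i : ℤ) (k l : ℕ) : monoLift f (monoVec i k l) = f i k l := by
  simp [monoLift, monoVec]

theorem monoSpace_hom_ext {M : Type*} [AddCommGroup M] [Module ℂ M] {f g : MonoSpace →ₗ[ℂ] M}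
    (h : ∀ i k l, f (monoVec i k l) = g (monoVec i k l)) : f = g := by
  apply Finsupp.lhom_ext'
  rintro ⟨i, k, l⟩
  ext
  exact h i k l

/-- Left multiplication by `α`. -/
def opA (q : Set.Ioo (0 : ℝ) 1) : Module.End ℂ MonoSpace := monoLift fun i k l =>
  qc q ^ (k + l) • (monoVec (i + 1) k l - raiseCoeff q i • monoVec (i + 1) (k + 1) (l + 1))

/-- Left multiplication by `α*`. -/
def opAs (q : Set.Ioo (0 : ℝ) 1) : Module.End ℂ MonoSpace := monoLift fun i k l =>
  (qc q)⁻¹ ^ (k + l) • (monoVec (i - 1) k l - lowerCoeff i • monoVec (i - 1) (k + 1) (l + 1))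

/-- Left multiplication by `γ`. -/
def opC : Module.End ℂ MonoSpace := monoLift fun i k l => monoVec i (k + 1) l

/-- Left multiplication by `γ*`. -/
def opCs : Module.End ℂ MonoSpace := monoLift fun i k l => monoVec i k (l + 1)

/-- The operators are read off from the multiplication rules for monomials. In α*α and αα* exactly
one of the two factors meets a nonzero correction coefficient, which one depending on the sign of i,
and it supplies the γγ* term of the relation. -/
theorem op_sat (q : Set.Ioo (0 : ℝ) 1) : Satisfies q (opA q) (opAs q) opC opCs := by
  have h0 := qc_ne q
  constructor <;> apply monoSpace_hom_ext <;> intro i k l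
  · rcases lt_or_ge i 0 with hi | hi
    · simp [opA, opAs, opC, opCs, raiseCoeff, lowerCoeff, hi, not_lt.2 (show i + 1 ≤ 0 by omega)]
      match_scalars <;> field_simp
      ring
    · simp [opA, opAs, opC, opCs, raiseCoeff, lowerCoeff, not_lt.2 hi,
        show 0 < i + 1 by omega]
      match_scalars <;> field_simp
      ring
  · rcases lt_or_ge 0 i with hi | hi
    · simp [opA, opAs, opC, opCs, raiseCoeff, lowerCoeff, hi, show ¬ i < 1 by omega]
      match_scalars <;> field_simp
      ring
    · simp [opA, opAs, opC, opCs, raiseCoeff, lowerCoeff, not_lt.2 hi, show i < 1 by omega]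
      match_scalars <;> field_simp
      ring
  · simp [opC, opCs]
  · simp [opA, opC]
    match_scalars <;> ring
  · simp [opA, opCs]
    match_scalars <;> ring
  · simp [opAs, opCs]
    match_scalars <;> field_simp <;> ring
  · simp [opAs, opC]
    match_scalars <;> field_simp <;> ring

/-- The representation of `𝒜` on the span of the monomials. -/
def monoRep (q : Set.Ioo (0 : ℝ) 1) : SUq q →ₐ[ℂ] Module.End ℂ MonoSpace :=
  lift _ _ _ _ (op_sat q)

/-- The linear map which sends a basis vector to the corresponding monomial. -/
def monoEval (q : Set.Ioo (0 : ℝ) 1) : MonoSpace →ₗ[ℂ] SUq q := monoLift (mono q)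

/-- Evaluation intertwines the representation with left multiplication. Applied to the vector of the
monomial 1, this shows that the monomials span `𝒜`. -/
theorem monoEval_monoRep (a : SUq q) (v : MonoSpace) :
    monoEval q (monoRep q a v) = a * monoEval q v := by
  induction a using induct generalizing v with
  | hc z => simp [Algebra.smul_def]
  | hg x =>
    have key : monoEval q ∘ₗ monoRep q (gen q x) =
        LinearMap.mulLeft ℂ (gen q x) ∘ₗ monoEval q := by
      apply monoSpace_hom_ext
      intro i k l
      cases x <;> simp [monoRep, monoEval, opA, opAs, opC, opCs, a_mul_mono, as_mul_mono,
        c_mul_mono, cs_mul_mono]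
    exact DFunLike.congr_fun key v
  | ha x y hx hy => simp [add_mul, hx, hy]
  | hm x y hx hy => simp [hx, hy, mul_assoc]

theorem mono_zero (q : Set.Ioo (0 : ℝ) 1) : mono q 0 0 0 = 1 := by
  simp [mono, show alphaPow q 0 = 1 from pow_zero _]

theorem monoEval_surjective (q : Set.Ioo (0 : ℝ) 1) : Function.Surjective (monoEval q) := by
  intro a
  refine ⟨monoRep q a (monoVec 0 0 0), ?_⟩
  rw [monoEval_monoRep]
  simp [monoEval, mono_zero]

theorem linearMap_ext_mono {M : Type*} [AddCommGroup M] [Module ℂ M] {f g : SUq q →ₗ[ℂ] M}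
    (h : ∀ i k l, f (mono q i k l) = g (mono q i k l)) : f = g := by
  have key : f ∘ₗ monoEval q = g ∘ₗ monoEval q := by
    apply monoSpace_hom_ext
    intro i k l
    simpa [monoEval] using h i k l
  ext a
  obtain ⟨v, rfl⟩ := monoEval_surjective q a
  exact DFunLike.congr_fun key v

/-- The vector of 1 is cyclic and separates the monomials, so they are linearly independent.
Functionals such as `haar` may therefore be prescribed freely on them. -/
theorem monoRep_mono (i : ℤ) (k l : ℕ) :
    monoRep q (mono q i k l) (monoVec 0 0 0) = monoVec i k l := by
  have h1 : ∀ n : ℕ, monoRep q (alphaPow q n) (monoVec 0 0 0) = monoVec n 0 0 := by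
    intro n
    induction n with
    | zero => simp [alphaPow]
    | succ n ih =>
      rw [alphaPow_natCast] at ih ⊢
      rw [pow_succ', map_mul, Module.End.mul_apply, ih]
      simp [monoRep, opA, raiseCoeff]
  have h2 : ∀ n : ℕ, monoRep q (alphaPow q (-n)) (monoVec 0 0 0) = monoVec (-n) 0 0 := by
    intro n
    induction n with
    | zero => simp [alphaPow]
    | succ n ih =>
      rw [alphaPow_neg_natCast] at ih ⊢
      rw [pow_succ', map_mul, Module.End.mul_apply, ih]
      have h0 : lowerCoeff (-(n : ℤ)) = 0 := if_neg (by omega)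
      simp only [monoRep, lift_as, opAs, monoLift_monoVec, h0, add_zero, pow_zero, one_smul,
        zero_smul, sub_zero]
      congr 1
      push_cast
      ring
  have h3 : monoRep q (alphaPow q i) (monoVec 0 0 0) = monoVec i 0 0 := by
    obtain ⟨n, rfl | rfl⟩ := i.eq_nat_or_neg
    · exact h1 n
    · exact h2 n
  have h4 : ∀ l, monoRep q (mono q i 0 l) (monoVec 0 0 0) = monoVec i 0 l := by
    intro l
    induction l with
    | zero => simpa [mono] using h3
    | succ l ih =>
      rw [← cs_mul_mono, map_mul, Module.End.mul_apply, ih]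
      simp [monoRep, opCs]
  induction k with
  | zero => exact h4 l
  | succ k ih =>
    rw [← c_mul_mono, map_mul, Module.End.mul_apply, ih]
    simp [monoRep, opC]

/-! ### The Haar functional -/

/-- The value `(1 - q²)/(1 - q^{2k+2})` of the Haar state at `(γγ*)^k`. -/
def haarValue (q : Set.Ioo (0 : ℝ) 1) (k : ℕ) : ℂ := (1 - qc q ^ 2) / (1 - qc q ^ (2 * k + 2))

/-- The functional on `𝒜` with `(γγ*)^k ↦ (1 - q²)/(1 - q^{2k+2})`, which vanishes on all other
ordered monomials. -/
def haar (q : Set.Ioo (0 : ℝ) 1) : Module.Dual ℂ (SUq q) :=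
  monoLift (fun i k l => if i = 0 ∧ k = l then haarValue q k else 0) ∘ₗ
    LinearMap.applyₗ (monoVec 0 0 0) ∘ₗ (monoRep q).toLinearMap

theorem haar_mono (i : ℤ) (k l : ℕ) :
    haar q (mono q i k l) = if i = 0 ∧ k = l then haarValue q k else 0 := by
  simp [haar, monoRep_mono]

theorem haar_one (q : Set.Ioo (0 : ℝ) 1) : haar q 1 = 1 := by
  rw [← mono_zero, haar_mono]
  have := qc_pow_ne_one q two_ne_zero
  simp [haarValue, div_self (sub_ne_zero.2 this.symm)]

theorem alphaPow_mem_A (i : ℤ) : alphaPow q i ∈ A q i := by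
  obtain ⟨n, rfl | rfl⟩ := i.eq_nat_or_neg
  · induction n with
    | zero => simpa [alphaPow] using one_mem_A
    | succ n ih =>
      rw [alphaPow_natCast] at ih ⊢
      rw [pow_succ]
      exact mul_mem_A (by push_cast; ring) ih a_mem_A
  · induction n with
    | zero => simpa [alphaPow] using one_mem_A
    | succ n ih =>
      rw [alphaPow_neg_natCast] at ih ⊢
      rw [pow_succ]
      exact mul_mem_A (by push_cast; ring) ih as_mem_A

theorem c_pow_mem_A (n : ℕ) : gen q Gen.c ^ n ∈ A q n := by
  induction n with
  | zero => simpa using one_mem_A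
  | succ n ih =>
    rw [pow_succ]
    exact mul_mem_A (by push_cast; ring) ih c_mem_A

theorem cs_pow_mem_A (n : ℕ) : gen q Gen.cs ^ n ∈ A q (-n) := by
  induction n with
  | zero => simpa using one_mem_A
  | succ n ih =>
    rw [pow_succ]
    exact mul_mem_A (by push_cast; ring) ih cs_mem_A

theorem mono_mem_A (i : ℤ) (k l : ℕ) : mono q i k l ∈ A q (i + k - l) :=
  mul_mem_A (by ring) (mul_mem_A rfl (c_pow_mem_A k) (cs_pow_mem_A l)) (alphaPow_mem_A i)

theorem haar_leftAct_kPow (n : ℤ) (a : SUq q) : haar q (leftAct (kPow q n) a) = haar q a := by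
  have key : haar q ∘ₗ leftAct (kPow q n) = haar q := by
    apply linearMap_ext_mono
    intro i k l
    rw [LinearMap.comp_apply, leftAct_kPow_of_mem (mono_mem_A i k l), map_smul, haar_mono]
    split_ifs with h
    · rw [h.1, h.2]
      simp
    · simp
  exact DFunLike.congr_fun key a

theorem rightAct_kPow_pow {x : SUq q} {n m : ℤ} (h : rightAct (kPow q n) x = qh q ^ m • x)
    (j : ℕ) : rightAct (kPow q n) (x ^ j) = qh q ^ (m * j) • x ^ j := by
  induction j with
  | zero => simp [rightAct_kPow_one]
  | succ j ih =>
    rw [pow_succ, rightAct_kPow_mul, ih, h, smul_mul_smul_comm, ← zpow_add₀ (qh_ne q)]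
    congr 2
    push_cast
    ring

theorem rightAct_kPow_mono (n i : ℤ) (k l : ℕ) :
    rightAct (kPow q n) (mono q i k l) = qh q ^ (n * (i - k + l)) • mono q i k l := by
  have h : rightAct (kPow q n) (alphaPow q i) = qh q ^ (n * i) • alphaPow q i := by
    obtain ⟨m, rfl | rfl⟩ := i.eq_nat_or_neg
    · exact rightAct_kPow_pow (rightAct_kPow_a n) m
    · rw [alphaPow_neg_natCast, rightAct_kPow_pow (rightAct_kPow_as n) m]
      congr 2
      ring
  unfold mono
  rw [rightAct_kPow_mul, rightAct_kPow_mul, rightAct_kPow_pow (rightAct_kPow_c n),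
    rightAct_kPow_pow (rightAct_kPow_cs n), h, smul_mul_smul_comm, smul_mul_smul_comm,
    ← zpow_add₀ (qh_ne q), ← zpow_add₀ (qh_ne q)]
  congr 2
  ring

theorem haar_rightAct_kPow (n : ℤ) (a : SUq q) : haar q (rightAct (kPow q n) a) = haar q a := by
  have key : haar q ∘ₗ rightAct (kPow q n) = haar q := by
    apply linearMap_ext_mono
    intro i k l
    rw [LinearMap.comp_apply, rightAct_kPow_mono, map_smul, haar_mono]
    split_ifs with h
    · rw [h.1, h.2]
      simp
    · simp
  exact DFunLike.congr_fun key a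

/-- The Haar functional vanishes on elements of nonzero weight with respect to the left action. -/
theorem haar_eq_zero_of_mem_A {n : ℤ} (hn : n ≠ 0) {a : SUq q} (ha : a ∈ A q n) :
    haar q a = 0 := by
  have h := haar_leftAct_kPow 1 a
  rw [mem_A.1 ha, map_smul, smul_eq_mul] at h
  by_contra h0
  exact qh_zpow_ne_one q hn (mul_eq_right₀ h0 |>.1 h)

/-- The Haar functional vanishes on elements of nonzero weight with respect to the right action. -/
theorem haar_eq_zero_of_rightAct {n : ℤ} (hn : n ≠ 0) {a : SUq q}
    (ha : rightAct (kPow q 1) a = qh q ^ n • a) : haar q a = 0 := by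
  have h := haar_rightAct_kPow 1 a
  rw [ha, map_smul, smul_eq_mul] at h
  by_contra h0
  exact qh_zpow_ne_one q hn (mul_eq_right₀ h0 |>.1 h)

/-! ### `∂_e` and `∂_f` on monomials -/

theorem one_sub_qc_pow_ne_zero (q : Set.Ioo (0 : ℝ) 1) {n : ℕ} (hn : n ≠ 0) :
    1 - qc q ^ n ≠ 0 :=
  sub_ne_zero.2 (qc_pow_ne_one q hn).symm

theorem leftAct_pow_eq_zero {φ : Module.Dual ℂ (SUq q)} (hφ : IsTwistedDer φ) {x : SUq q}
    (hx : leftAct φ x = 0) (n : ℕ) : leftAct φ (x ^ n) = 0 := by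
  induction n with
  | zero => rw [pow_zero, ← map_one (algebraMap ℂ (SUq q)), leftAct_twisted_algebraMap hφ]
  | succ n ih => rw [pow_succ, leftAct_leibniz hφ, ih, hx, zero_mul, mul_zero, add_zero]

/-- The coefficient in `∂_e(γ*^{l+1}) = ePowCoeff l • γ*^l α`. -/
def ePowCoeff (q : Set.Ioo (0 : ℝ) 1) (l : ℕ) : ℂ :=
  -((qc q)⁻¹ * (qh q)⁻¹ ^ l * ((1 - qc q ^ (2 * l + 2)) / (1 - qc q ^ 2)))

theorem ePowCoeff_ne_zero (q : Set.Ioo (0 : ℝ) 1) (l : ℕ) : ePowCoeff q l ≠ 0 :=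
  neg_ne_zero.2 (mul_ne_zero (mul_ne_zero (inv_ne_zero (qc_ne q))
    (pow_ne_zero _ (inv_ne_zero (qh_ne q))))
    (div_ne_zero (one_sub_qc_pow_ne_zero q (by omega)) (one_sub_qc_pow_ne_zero q two_ne_zero)))

theorem leftAct_e_cs_pow (l : ℕ) : leftAct (ePair q) (gen q Gen.cs ^ (l + 1)) =
    ePowCoeff q l • (gen q Gen.cs ^ l * gen q Gen.a) := by
  induction l with
  | zero =>
    have := one_sub_qc_pow_ne_zero q two_ne_zero
    simp [leftAct_e_cs, ePowCoeff, div_self this]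
  | succ l ih =>
    rw [pow_succ', leftAct_twisted_mul ePair_mul cs_mem_A (cs_pow_mem_A _), ih, leftAct_e_cs,
      neg_mul, smul_mul_assoc, mul_pow_of_smul_comm a_cs, mul_smul_comm, ← mul_assoc, ← pow_succ',
      neg_neg, zpow_natCast, zpow_neg_one]
    match_scalars
    have h1 := one_sub_qc_pow_ne_zero q two_ne_zero
    have h0 := qh_ne q
    simp only [ePowCoeff]
    -- The denominator is kept opaque while `qc q` is expanded as the square of `qh q`, so that its
    -- nonvanishing stays usable; it is restored for the final polynomial identity.
    generalize hD : 1 - qc q ^ 2 = D at *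
    simp only [← qh_sq, inv_pow] at *
    field_simp
    subst hD
    ring

/-- The coefficient in `∂_f(γ^{k+1}) = fPowCoeff k • γ^k α*`. -/
def fPowCoeff (q : Set.Ioo (0 : ℝ) 1) (k : ℕ) : ℂ :=
  (qh q)⁻¹ ^ (3 * k) * ((1 - qc q ^ (2 * k + 2)) / (1 - qc q ^ 2))

theorem fPowCoeff_ne_zero (q : Set.Ioo (0 : ℝ) 1) (k : ℕ) : fPowCoeff q k ≠ 0 :=
  mul_ne_zero (pow_ne_zero _ (inv_ne_zero (qh_ne q)))
    (div_ne_zero (one_sub_qc_pow_ne_zero q (by omega)) (one_sub_qc_pow_ne_zero q two_ne_zero))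

theorem leftAct_f_c_pow (k : ℕ) : leftAct (fPair q) (gen q Gen.c ^ (k + 1)) =
    fPowCoeff q k • (gen q Gen.c ^ k * gen q Gen.as) := by
  induction k with
  | zero =>
    have := one_sub_qc_pow_ne_zero q two_ne_zero
    simp [leftAct_f_c, fPowCoeff, div_self this]
  | succ k ih =>
    rw [pow_succ', leftAct_twisted_mul fPair_mul c_mem_A (c_pow_mem_A _), ih, leftAct_f_c,
      mul_pow_of_smul_comm as_c, mul_smul_comm, ← mul_assoc, ← pow_succ', zpow_neg, zpow_natCast,
      zpow_one]
    match_scalars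
    have h1 := one_sub_qc_pow_ne_zero q two_ne_zero
    have h0 := qh_ne q
    simp only [fPowCoeff]
    generalize hD : 1 - qc q ^ 2 = D at *
    simp only [← qh_sq, inv_pow] at *
    field_simp
    subst hD
    ring

theorem leftAct_e_c_cs_pow (k l : ℕ) :
    leftAct (ePair q) (gen q Gen.c ^ k * gen q Gen.cs ^ (l + 1)) =
      (qh q ^ k * ePowCoeff q l) • (gen q Gen.c ^ k * gen q Gen.cs ^ l * gen q Gen.a) := by
  rw [leftAct_twisted_mul ePair_mul (c_pow_mem_A k) (cs_pow_mem_A _), leftAct_e_cs_pow,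
    leftAct_pow_eq_zero ePair_mul leftAct_e_c, zero_mul, smul_zero, zero_add, mul_smul_comm,
    smul_smul, zpow_natCast, mul_assoc]

theorem leftAct_f_c_cs_pow (k l : ℕ) :
    leftAct (fPair q) (gen q Gen.c ^ (k + 1) * gen q Gen.cs ^ l) =
      (qh q ^ l * fPowCoeff q k * (qc q)⁻¹ ^ l) •
        (gen q Gen.c ^ k * gen q Gen.cs ^ l * gen q Gen.as) := by
  rw [leftAct_twisted_mul fPair_mul (c_pow_mem_A _) (cs_pow_mem_A l), leftAct_f_c_pow,
    leftAct_pow_eq_zero fPair_mul leftAct_f_cs, mul_zero, smul_zero, add_zero, smul_mul_assoc,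
    mul_assoc, mul_pow_of_smul_comm as_cs, mul_smul_comm, neg_neg, zpow_natCast, smul_smul,
    smul_smul]
  simp only [mul_assoc]

/-- ∂_e kills α and γ, so only γ* contributes. The scalar is nonzero, hence every monomial with a
positive power of α lies in the image of ∂_e. -/
theorem leftAct_e_mono_natCast (n k l : ℕ) : leftAct (ePair q) (mono q n k (l + 1)) =
    (qh q ^ (-n : ℤ) * (qh q ^ k * ePowCoeff q l)) • mono q (n + 1) k l := by
  unfold mono
  rw [leftAct_twisted_mul ePair_mul (mul_mem_A rfl (c_pow_mem_A k) (cs_pow_mem_A _))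
    (alphaPow_mem_A n), leftAct_e_c_cs_pow, alphaPow_natCast,
    leftAct_pow_eq_zero ePair_mul leftAct_e_a, mul_zero, smul_zero, add_zero, smul_mul_assoc,
    smul_smul, mul_assoc _ (gen q Gen.a), ← pow_succ', ← alphaPow_natCast, Nat.cast_succ]

/-- The mirror statement: ∂_f kills α* and γ*, and every monomial with a positive power of α* lies
in its image. -/
theorem leftAct_f_mono_neg_natCast (n k l : ℕ) : leftAct (fPair q) (mono q (-n) (k + 1) l) =
    (qh q ^ (n : ℤ) * (qh q ^ l * fPowCoeff q k * (qc q)⁻¹ ^ l)) • mono q (-(n + 1)) k l := by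
  unfold mono
  rw [leftAct_twisted_mul fPair_mul (mul_mem_A rfl (c_pow_mem_A _) (cs_pow_mem_A _))
    (alphaPow_mem_A _), leftAct_f_c_cs_pow, alphaPow_neg_natCast,
    leftAct_pow_eq_zero fPair_mul leftAct_f_as, mul_zero, smul_zero, add_zero, smul_mul_assoc,
    smul_smul, mul_assoc _ (gen q Gen.as), ← pow_succ', ← alphaPow_neg_natCast, Nat.cast_succ,
    neg_neg]

theorem alphaPow_one (q : Set.Ioo (0 : ℝ) 1) : alphaPow q 1 = gen q Gen.a := pow_one _

theorem alphaPow_neg_one (q : Set.Ioo (0 : ℝ) 1) : alphaPow q (-1) = gen q Gen.as := pow_one _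

theorem mono_zero_left (k l : ℕ) : mono q 0 k l = gen q Gen.c ^ k * gen q Gen.cs ^ l := by
  rw [mono, show alphaPow q 0 = 1 from pow_zero _, mul_one]

theorem c_pow_cs_pow_mul_c (k l : ℕ) :
    gen q Gen.c ^ k * gen q Gen.cs ^ l * gen q Gen.c = mono q 0 (k + 1) l := by
  rw [mono_zero_left, mul_assoc, ← (commute_c_cs.pow_right l).eq, ← mul_assoc, ← pow_succ]

theorem c_pow_cs_pow_mul_cs (k l : ℕ) :
    gen q Gen.c ^ k * gen q Gen.cs ^ l * gen q Gen.cs = mono q 0 k (l + 1) := by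
  rw [mono_zero_left, mul_assoc, ← pow_succ]

theorem c_pow_cs_pow_mul_c_cs (k l : ℕ) :
    gen q Gen.c ^ k * gen q Gen.cs ^ l * (gen q Gen.c * gen q Gen.cs) =
      mono q 0 (k + 1) (l + 1) := by
  rw [← mul_assoc, c_pow_cs_pow_mul_c, mono_zero_left, c_pow_cs_pow_mul_cs]

theorem mono_neg_one_mul_a (k l : ℕ) :
    mono q (-1) k l * gen q Gen.a = mono q 0 k l - mono q 0 (k + 1) (l + 1) := by
  rw [mono, alphaPow_neg_one, mul_assoc, as_a, mul_sub, mul_one, c_pow_cs_pow_mul_c_cs,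
    ← mono_zero_left]

theorem mono_one_mul_as (k l : ℕ) :
    mono q 1 k l * gen q Gen.as = mono q 0 k l - qc q ^ 2 • mono q 0 (k + 1) (l + 1) := by
  rw [mono, alphaPow_one, mul_assoc, a_as, mul_sub, mul_one, mul_smul_comm,
    c_pow_cs_pow_mul_c_cs, ← mono_zero_left]

/-- Here both γ* and α* contribute. An invariant functional must kill this difference, so its values
satisfy (1 - q^{2k+4}) h_{k+1} = (1 - q^{2k+2}) h_k; this is the origin of `haarValue`. -/
theorem leftAct_e_mono_neg_one (k : ℕ) : leftAct (ePair q) (mono q (-1) k (k + 1)) =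
    ((qh q)⁻¹ / (1 - qc q ^ 2)) • ((1 - qc q ^ (2 * (k + 1) + 2)) • mono q 0 (k + 1) (k + 1) -
      (1 - qc q ^ (2 * k + 2)) • mono q 0 k k) := by
  have h := mono_one_mul_as (q := q) k k
  rw [mono, alphaPow_one] at h
  rw [mono, alphaPow_neg_one, leftAct_twisted_mul ePair_mul
    (mul_mem_A rfl (c_pow_mem_A k) (cs_pow_mem_A _)) as_mem_A, leftAct_e_c_cs_pow, leftAct_e_as,
    smul_mul_assoc, h, c_pow_cs_pow_mul_c, neg_neg, zpow_one,
    show (k : ℤ) + -((k + 1 : ℕ) : ℤ) = -1 by push_cast; ring, zpow_neg_one]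
  have h1 := one_sub_qc_pow_ne_zero q two_ne_zero
  have h0 := qh_ne q
  simp only [ePowCoeff]
  generalize hD : 1 - qc q ^ 2 = D at *
  simp only [← qh_sq, inv_pow] at *
  match_scalars <;> field_simp
  subst hD
  ring

theorem leftAct_f_mono_one (k : ℕ) : leftAct (fPair q) (mono q 1 (k + 1) k) =
    ((qh q)⁻¹ ^ (4 * k + 1) / (1 - qc q ^ 2)) • ((1 - qc q ^ (2 * k + 2)) • mono q 0 k k -
      (1 - qc q ^ (2 * (k + 1) + 2)) • mono q 0 (k + 1) (k + 1)) := by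
  have h := mono_neg_one_mul_a (q := q) k k
  rw [mono, alphaPow_neg_one] at h
  rw [mono, alphaPow_one, leftAct_twisted_mul fPair_mul
    (mul_mem_A rfl (c_pow_mem_A _) (cs_pow_mem_A _)) a_mem_A, leftAct_f_c_cs_pow, leftAct_f_a,
    smul_mul_assoc, h, mul_neg, mul_smul_comm, c_pow_cs_pow_mul_cs,
    show ((k + 1 : ℕ) : ℤ) + -(k : ℤ) = 1 by push_cast; ring, zpow_neg_one, zpow_one]
  have h1 := one_sub_qc_pow_ne_zero q two_ne_zero
  have h0 := qh_ne q
  simp only [fPowCoeff]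
  generalize hD : 1 - qc q ^ 2 = D at *
  simp only [← qh_sq, inv_pow] at *
  match_scalars <;> field_simp <;> subst hD <;> ring

/-! ### Weights -/

/-- `x` has weight `m` for `∂_k` and weight `n` for the right action of `k`. -/
def HasWeights (m n : ℤ) (x : SUq q) : Prop :=
  x ∈ A q m ∧ rightAct (kPow q 1) x = qh q ^ n • x

theorem HasWeights.mul {m n m' n' : ℤ} {x y : SUq q} (hx : HasWeights m n x)
    (hy : HasWeights m' n' y) : HasWeights (m + m') (n + n') (x * y) := by
  refine ⟨mul_mem_A rfl hx.1 hy.1, ?_⟩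
  rw [rightAct_kPow_mul, hx.2, hy.2, smul_mul_smul_comm, zpow_add₀ (qh_ne q)]

theorem HasWeights.haar_eq_zero {m n : ℤ} {x : SUq q} (hx : HasWeights m n x)
    (h : m ≠ 0 ∨ n ≠ 0) : haar q x = 0 :=
  h.elim (fun h => haar_eq_zero_of_mem_A h hx.1) (fun h => haar_eq_zero_of_rightAct h hx.2)

theorem HasWeights.leftAct_e {m n : ℤ} {x : SUq q} (hx : HasWeights m n x) :
    HasWeights (m + 2) n (leftAct (ePair q) x) :=
  ⟨e_mem_A rfl hx.1, by rw [← leftAct_rightAct, hx.2, map_smul]⟩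

theorem HasWeights.leftAct_f {m n : ℤ} {x : SUq q} (hx : HasWeights m n x) :
    HasWeights (m - 2) n (leftAct (fPair q) x) :=
  ⟨f_mem_A rfl hx.1, by rw [← leftAct_rightAct, hx.2, map_smul]⟩

theorem hasWeights_mono (i : ℤ) (k l : ℕ) : HasWeights (i + k - l) (i - k + l) (mono q i k l) :=
  ⟨mono_mem_A i k l, by rw [rightAct_kPow_mono, one_mul]⟩

theorem hasWeights_a : HasWeights 1 1 (gen q Gen.a) := ⟨a_mem_A, rightAct_kPow_a 1⟩
theorem hasWeights_as : HasWeights (-1) (-1) (gen q Gen.as) := ⟨as_mem_A, rightAct_kPow_as 1⟩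
theorem hasWeights_c : HasWeights 1 (-1) (gen q Gen.c) := ⟨c_mem_A, rightAct_kPow_c 1⟩
theorem hasWeights_cs : HasWeights (-1) 1 (gen q Gen.cs) := ⟨cs_mem_A, rightAct_kPow_cs 1⟩

/-! ### Invariance of the Haar functional -/

theorem haar_mono_zero (k : ℕ) : haar q (mono q 0 k k) = haarValue q k := by
  rw [haar_mono, if_pos ⟨rfl, rfl⟩]

theorem one_sub_mul_haarValue (q : Set.Ioo (0 : ℝ) 1) (k : ℕ) :
    (1 - qc q ^ (2 * k + 2)) * haarValue q k = 1 - qc q ^ 2 :=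
  mul_div_cancel₀ _ (one_sub_qc_pow_ne_zero q (by omega))

theorem haar_leftAct_e (a : SUq q) : haar q (leftAct (ePair q) a) = 0 := by
  have key : haar q ∘ₗ leftAct (ePair q) = 0 := by
    apply linearMap_ext_mono
    intro i k l
    rw [LinearMap.comp_apply, LinearMap.zero_apply]
    -- ∂_e of the monomial has weights i + k - l + 2 and i - k + l. Both vanish exactly in this
    -- case; otherwise the Haar functional is zero for weight reasons.
    by_cases h : i = -1 ∧ l = k + 1
    · obtain ⟨rfl, rfl⟩ := h
      simp only [leftAct_e_mono_neg_one, map_smul, map_sub, haar_mono_zero, smul_eq_mul,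
        one_sub_mul_haarValue, sub_self, mul_zero]
    · exact (hasWeights_mono i k l).leftAct_e.haar_eq_zero (by omega)
  exact DFunLike.congr_fun key a

theorem haar_leftAct_f (a : SUq q) : haar q (leftAct (fPair q) a) = 0 := by
  have key : haar q ∘ₗ leftAct (fPair q) = 0 := by
    apply linearMap_ext_mono
    intro i k l
    rw [LinearMap.comp_apply, LinearMap.zero_apply]
    -- The weights are now i + k - l - 2 and i - k + l.
    by_cases h : i = 1 ∧ k = l + 1
    · obtain ⟨rfl, rfl⟩ := h
      simp only [leftAct_f_mono_one, map_smul, map_sub, haar_mono_zero, smul_eq_mul,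
        one_sub_mul_haarValue, sub_self, mul_zero]
    · exact (hasWeights_mono i k l).leftAct_f.haar_eq_zero (by omega)
  exact DFunLike.congr_fun key a

theorem leftAct_haar_leftAct (φ : Module.Dual ℂ (SUq q)) (a : SUq q) :
    leftAct (haar q) (leftAct φ a) = leftAct (haar q ∘ₗ leftAct φ) a := by
  rw [← leftAct_conv]
  congr 2
  ext x
  exact conv_apply_leftAct _ _ x

theorem leftAct_zero (a : SUq q) : leftAct (0 : Module.Dual ℂ (SUq q)) a = 0 := by
  simp [leftAct]

/-- By associativity of convolution, a ↦ (ι ⊗ h)Δ(a) inherits from h the vanishing on the images of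
∂_e and ∂_f and the invariance under ∂_k. These properties determine it on all monomials up to its
value at 1, so it must be h(·)1. -/
theorem leftAct_haar (a : SUq q) : leftAct (haar q) a = algebraMap ℂ (SUq q) (haar q a) := by
  have he : ∀ a, leftAct (haar q) (leftAct (ePair q) a) = 0 := fun a => by
    rw [leftAct_haar_leftAct, show haar q ∘ₗ leftAct (ePair q) = 0 from
      LinearMap.ext haar_leftAct_e, leftAct_zero]
  have hf : ∀ a, leftAct (haar q) (leftAct (fPair q) a) = 0 := fun a => by
    rw [leftAct_haar_leftAct, show haar q ∘ₗ leftAct (fPair q) = 0 from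
      LinearMap.ext haar_leftAct_f, leftAct_zero]
  have hk : ∀ a, leftAct (haar q) (leftAct (kPow q 1) a) = leftAct (haar q) a := fun a => by
    rw [leftAct_haar_leftAct, show haar q ∘ₗ leftAct (kPow q 1) = haar q from
      LinearMap.ext (haar_leftAct_kPow 1)]
  -- Vanishing on ∂_e of γ^k(γ*)^{k+1}α* gives the operator the same recursion in k as `haarValue`,
  -- with the same start at k = 0.
  have h0 : ∀ k, leftAct (haar q) (mono q 0 k k) =
      algebraMap ℂ (SUq q) (haar q (mono q 0 k k)) := by
    intro k
    induction k with
    | zero =>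
      rw [mono_zero, ← map_one (algebraMap ℂ (SUq q)), leftAct_algebraMap, haar_one, map_one,
        haar_one, one_mul]
    | succ k ih =>
      have h1 := he (mono q (-1) k (k + 1))
      have h2 := one_sub_qc_pow_ne_zero q (n := 2 * (k + 1) + 2) (by omega)
      rw [leftAct_e_mono_neg_one, map_smul, smul_eq_zero_iff_right
        (div_ne_zero (inv_ne_zero (qh_ne q)) (one_sub_qc_pow_ne_zero q two_ne_zero)), map_sub,
        map_smul, map_smul, ih, sub_eq_zero, haar_mono_zero, Algebra.algebraMap_eq_smul_one,
        smul_smul, one_sub_mul_haarValue, ← one_sub_mul_haarValue q (k + 1), ← smul_smul,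
        ← Algebra.algebraMap_eq_smul_one] at h1
      rw [haar_mono_zero]
      exact smul_right_injective _ h2 h1
  have key : leftAct (haar q) = Algebra.linearMap ℂ (SUq q) ∘ₗ haar q := by
    apply linearMap_ext_mono
    intro i k l
    rw [LinearMap.comp_apply, Algebra.linearMap_apply]
    by_cases hw : i + k - l = 0
    · rcases lt_trichotomy i 0 with hi | rfl | hi
      · obtain ⟨n, rfl⟩ : ∃ n : ℕ, i = -(n + 1) := ⟨(-i - 1).toNat, by omega⟩
        have h := hf (mono q (-n) (k + 1) l)
        rw [leftAct_f_mono_neg_natCast, map_smul, smul_eq_zero_iff_right] at h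
        · rw [h, haar_mono, if_neg (by omega), map_zero]
        · have := qh_ne q
          have := qc_ne q
          have := fPowCoeff_ne_zero q k
          positivity
      · obtain rfl : k = l := by omega
        exact h0 k
      · obtain ⟨n, rfl⟩ : ∃ n : ℕ, i = n + 1 := ⟨(i - 1).toNat, by omega⟩
        have h := he (mono q n k (l + 1))
        rw [leftAct_e_mono_natCast, map_smul, smul_eq_zero_iff_right] at h
        · rw [h, haar_mono, if_neg (by omega), map_zero]
        · have := qh_ne q
          have := ePowCoeff_ne_zero q l
          positivity
    -- For nonzero weight, ∂_k multiplies the monomial by a scalar different from 1 without changing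
    -- its image, so the image is zero.
    · have h := hk (mono q i k l)
      rw [mem_A.1 (mono_mem_A i k l), map_smul] at h
      rw [haar_eq_zero_of_mem_A hw (mono_mem_A i k l), map_zero]
      by_contra h1
      exact qh_zpow_ne_one q hw (smul_left_injective ℂ h1 (by simpa using h))
  exact DFunLike.congr_fun key a

theorem rightAct_haar_transpose (a : SUq q) :
    rightAct (haar q ∘ₗ (transpose q).toLinearMap) a =
      algebraMap ℂ (SUq q) (haar q (transpose q a)) := by
  have h := transpose_rightAct (haar q) a
  rw [leftAct_haar] at h
  rw [← transpose_transpose (rightAct _ a), h, AlgHom.commutes]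

/-- A normalized left invariant functional agrees with a normalized right invariant one. -/
theorem invariant_unique {g h : Module.Dual ℂ (SUq q)} (hg : g 1 = 1) (hh : h 1 = 1)
    (hl : ∀ a, leftAct g a = algebraMap ℂ (SUq q) (g a))
    (hr : ∀ a, rightAct h a = algebraMap ℂ (SUq q) (h a)) : g = h := by
  ext a
  -- The convolution hg at a is computed twice: left invariance of g gives g(a)h(1), right
  -- invariance of h gives h(a)g(1).
  have h1 := conv_apply_leftAct h g a
  rw [conv_apply_rightAct, hl, hr, Algebra.algebraMap_eq_smul_one, Algebra.algebraMap_eq_smul_one,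
    map_smul, map_smul, hg, hh] at h1
  simpa using h1.symm

/-- `haar` is left invariant and its transpose is right invariant. Being normalized, the two agree,
so `haar` has both invariances. -/
theorem isHaarState_haar (q : Set.Ioo (0 : ℝ) 1) : IsHaarState (haar q) := by
  have h : haar q = haar q ∘ₗ (transpose q).toLinearMap :=
    invariant_unique (haar_one q) (by simp [haar_one]) leftAct_haar rightAct_haar_transpose
  refine ⟨haar_one q, leftAct_haar, fun a => ?_⟩
  have h1 := rightAct_haar_transpose a
  rw [← h] at h1
  rw [h1]
  exact congrArg _ (DFunLike.congr_fun h a).symm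

/-! ### The modular property -/

/-- The modular automorphism `b ↦ ∂_{k²}(b ◁ k²)`. -/
def modular (q : Set.Ioo (0 : ℝ) 1) : SUq q →ₗ[ℂ] SUq q :=
  leftAct (kPow q 2) ∘ₗ rightAct (kPow q 2)

theorem modular_mul (x y : SUq q) : modular q (x * y) = modular q x * modular q y := by
  simp only [modular, LinearMap.comp_apply, rightAct_kPow_mul, leftAct_kPow_mul]

theorem haar_mul_comm_of_mono (b : SUq q)
    (h : ∀ i k l, haar q (mono q i k l * b) = haar q (modular q b * mono q i k l)) (a : SUq q) :
    haar q (a * b) = haar q (modular q b * a) := by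
  have key : haar q ∘ₗ LinearMap.mulRight ℂ b = haar q ∘ₗ LinearMap.mulLeft ℂ (modular q b) := by
    apply linearMap_ext_mono
    simpa using h
  exact DFunLike.congr_fun key a

/-- This is h(xα) = q²h(αx) for x = γ^k(γ*)^kα*, written in values of the Haar functional. The same
identity serves α*. -/
theorem haarValue_sub (q : Set.Ioo (0 : ℝ) 1) (k : ℕ) :
    haarValue q k - haarValue q (k + 1) =
      qc q ^ (2 * k + 2) * (haarValue q k - qc q ^ 2 * haarValue q (k + 1)) := by
  have h1 := one_sub_qc_pow_ne_zero q (n := 2 * k + 2) (by omega)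
  have h2 := one_sub_qc_pow_ne_zero q (n := 2 * (k + 1) + 2) (by omega)
  unfold haarValue
  field_simp
  ring

/-- As `modular` is multiplicative, the b that satisfy this for all a form a subalgebra, so
generators suffice. For α and α* weights leave one family of monomials; γ and γ* commute with every
monomial having i = 0, and weights dispose of the others. -/
theorem haar_mul_comm (a b : SUq q) : haar q (a * b) = haar q (modular q b * a) := by
  have h2 : qh q ^ (2 : ℤ) = qc q := by rw [zpow_two, qh_sq]
  have h3 : qh q ^ (-2 : ℤ) = (qc q)⁻¹ := by rw [zpow_neg, h2]
  have h0 := qc_ne q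
  induction b using induct generalizing a with
  | hc z =>
    simp [modular, rightAct_algebraMap, leftAct_algebraMap, kPow, Algebra.commutes z a]
  | hg x =>
    apply haar_mul_comm_of_mono
    intro i k l
    cases x with
    | a =>
      have hm : modular q (gen q Gen.a) = qc q ^ 2 • gen q Gen.a := by
        simp [modular, rightAct_kPow_a, leftAct_kPow_a, h2, smul_smul, sq]
      rw [hm, smul_mul_assoc, map_smul]
      by_cases h : i = -1 ∧ k = l
      · obtain ⟨rfl, rfl⟩ := h
        rw [mono_neg_one_mul_a, a_mul_mono]
        simp only [raiseCoeff, neg_add_cancel, map_sub, map_smul, haar_mono_zero, smul_eq_mul,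
          haarValue_sub, show (-1 : ℤ) < 0 by norm_num, if_true]
        ring
      · rw [((hasWeights_mono i k l).mul hasWeights_a).haar_eq_zero (by omega),
          (hasWeights_a.mul (hasWeights_mono i k l)).haar_eq_zero (by omega), smul_zero]
    | as =>
      have hm : modular q (gen q Gen.as) = (qc q)⁻¹ ^ 2 • gen q Gen.as := by
        simp [modular, rightAct_kPow_as, leftAct_kPow_as, h3, smul_smul, sq]
      rw [hm, smul_mul_assoc, map_smul]
      by_cases h : i = 1 ∧ k = l
      · obtain ⟨rfl, rfl⟩ := h
        rw [mono_one_mul_as, as_mul_mono]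
        simp only [lowerCoeff, sub_self, map_sub, map_smul, haar_mono_zero, smul_eq_mul,
          haarValue_sub, zero_lt_one, if_true, one_mul]
        simp only [inv_pow]
        field_simp
        ring
      · rw [((hasWeights_mono i k l).mul hasWeights_as).haar_eq_zero (by omega),
          (hasWeights_as.mul (hasWeights_mono i k l)).haar_eq_zero (by omega), smul_zero]
    | c =>
      have hm : modular q (gen q Gen.c) = gen q Gen.c := by
        simp [modular, rightAct_kPow_c, leftAct_kPow_c, h2, h3, smul_smul, h0]
      rw [hm]
      by_cases h : i = 0
      · subst h
        rw [c_mul_mono, mono_zero_left, c_pow_cs_pow_mul_c]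
      · rw [((hasWeights_mono i k l).mul hasWeights_c).haar_eq_zero (by omega),
          (hasWeights_c.mul (hasWeights_mono i k l)).haar_eq_zero (by omega)]
    | cs =>
      have hm : modular q (gen q Gen.cs) = gen q Gen.cs := by
        simp [modular, rightAct_kPow_cs, leftAct_kPow_cs, h2, h3, smul_smul, h0]
      rw [hm]
      by_cases h : i = 0
      · subst h
        rw [cs_mul_mono, mono_zero_left, c_pow_cs_pow_mul_cs]
      · rw [((hasWeights_mono i k l).mul hasWeights_cs).haar_eq_zero (by omega),
          (hasWeights_cs.mul (hasWeights_mono i k l)).haar_eq_zero (by omega)]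
  | ha x y hx hy => simp [mul_add, add_mul, hx, hy]
  | hm x y hx hy => rw [← mul_assoc, hy, ← mul_assoc, hx, ← mul_assoc, modular_mul]

theorem haar_mul_comm_of_mem_A {m : ℤ} (a : SUq q) {b : SUq q} (hb : b ∈ A q m) :
    haar q (a * b) = qc q ^ m * haar q (rightAct (kPow q 2) b * a) := by
  rw [haar_mul_comm, modular, LinearMap.comp_apply,
    leftAct_kPow_of_mem (rightAct_mem_A _ hb), smul_mul_assoc, map_smul, smul_eq_mul, zpow_mul,
    zpow_two, qh_sq]

/-! ### Underlying elements of `𝒜`, and commutation of ∂_e with ∂_f on `ℬ` -/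

theorem qh_pow_two (q : Set.Ioo (0 : ℝ) 1) : qh q ^ 2 = qc q := by rw [sq, qh_sq]

theorem coe_mulA {m n p : ℤ} (h : m + n = p) (a : A q m) (b : A q n) :
    (mulA h a b : SUq q) = a * b := rfl

theorem coe_delE {m p : ℤ} (h : m + 2 = p) (a : A q m) :
    (delE h a : SUq q) = leftAct (ePair q) a := rfl

theorem coe_delF {m p : ℤ} (h : m - 2 = p) (a : A q m) :
    (delF h a : SUq q) = leftAct (fPair q) a := rfl

theorem coe_twist (a : A q 0) : (twist q a : SUq q) = rightAct (kPow q 2) a := rfl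

/-- On weight 0 both k² and k⁻² act trivially, so the commutator relation has zero right-hand side,
while q - q⁻¹ ≠ 0. -/
theorem leftAct_e_f_comm (b : A q 0) :
    leftAct (ePair q) (leftAct (fPair q) b) = leftAct (fPair q) (leftAct (ePair q) b) := by
  have h := leftAct_e_f_commutator (b : SUq q)
  rw [leftAct_kPow_of_mem b.2, leftAct_kPow_of_mem b.2, mul_zero, mul_zero, sub_self] at h
  have hq : qc q - (qc q)⁻¹ ≠ 0 := by
    intro h0
    apply qc_pow_ne_one q two_ne_zero
    have := qc_ne q
    field_simp at h0
    linear_combination h0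
  exact sub_eq_zero.1 ((smul_eq_zero_iff_right hq).1 h)

namespace DeRham

theorem d_a00 (x : DeRham q) : (d x).a00 = 0 := add_zero 0
theorem d_a01 (x : DeRham q) : (d x).a01 = delF (by norm_num) x.a00 := zero_add _
theorem d_a10 (x : DeRham q) : (d x).a10 = delE (by norm_num) x.a00 := add_zero _
theorem d_a11 (x : DeRham q) : (d x).a11 =
    qc q • delE (by norm_num) x.a01 + -(qc q • delF (by norm_num) x.a10) := rfl

theorem neg_a00 (x : DeRham q) : (-x).a00 = -x.a00 := rfl
theorem neg_a01 (x : DeRham q) : (-x).a01 = -x.a01 := rfl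
theorem neg_a10 (x : DeRham q) : (-x).a10 = -x.a10 := rfl
theorem neg_a11 (x : DeRham q) : (-x).a11 = -x.a11 := rfl

/-! ### The graded differential algebra structure -/

/-- The projection onto the component of degree `n`. -/
def degProj (q : Set.Ioo (0 : ℝ) 1) : ℕ → DeRham q →ₗ[ℂ] DeRham q
  | 0 =>
    { toFun x := ⟨x.a00, 0, 0, 0⟩
      map_add' x y := by apply DeRham.ext <;> simp
      map_smul' z x := by apply DeRham.ext <;> simp }
  | 1 =>
    { toFun x := ⟨0, x.a01, x.a10, 0⟩
      map_add' x y := by apply DeRham.ext <;> simp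
      map_smul' z x := by apply DeRham.ext <;> simp }
  | 2 =>
    { toFun x := ⟨0, 0, 0, x.a11⟩
      map_add' x y := by apply DeRham.ext <;> simp
      map_smul' z x := by apply DeRham.ext <;> simp }
  | _ => 0

theorem mem_deg_add_three {n : ℕ} {x : DeRham q} : x ∈ deg q (n + 3) ↔ x = 0 := Iff.rfl

theorem degProj_of_mem {m : ℕ} (n : ℕ) {x : DeRham q} (hx : x ∈ deg q m) :
    degProj q n x = if n = m then x else 0 := by
  rcases m with _ | _ | _ | m
  · obtain ⟨h1, h2, h3⟩ := hx
    rcases n with _ | _ | _ | n <;> apply DeRham.ext <;> simp [degProj, h1, h2, h3]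
  · obtain ⟨h1, h2⟩ := hx
    rcases n with _ | _ | _ | n <;> apply DeRham.ext <;> simp [degProj, h1, h2]
  · obtain ⟨h1, h2, h3⟩ := hx
    rcases n with _ | _ | _ | n <;> apply DeRham.ext <;> simp [degProj, h1, h2, h3]
  · obtain rfl : x = 0 := hx
    simp

theorem degProj_sum (x : DeRham q) : degProj q 0 x + degProj q 1 x + degProj q 2 x = x := by
  apply DeRham.ext <;> simp [degProj]

theorem degProj_mem (n : ℕ) (x : DeRham q) : degProj q n x ∈ deg q n := by
  rcases n with _ | _ | _ | n
  · exact ⟨rfl, rfl, rfl⟩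
  · exact ⟨rfl, rfl⟩
  · exact ⟨rfl, rfl, rfl⟩
  · rfl

/-- The projections `degProj` recover every component of a finite sum, which gives injectivity;
three of them add up to the identity, which gives surjectivity. -/
theorem isInternal_deg (q : Set.Ioo (0 : ℝ) 1) : DirectSum.IsInternal (deg q) := by
  have key : ∀ (n : ℕ) (y : DirectSum ℕ fun n => deg q n),
      degProj q n (DirectSum.coeAddMonoidHom (deg q) y) = y n := by
    intro n y
    induction y using DirectSum.induction_on with
    | zero => simp
    | of m x =>
      rw [DirectSum.coeAddMonoidHom_of, degProj_of_mem n x.2]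
      split_ifs with h
      · subst h
        rw [DirectSum.of_eq_same]
      · rw [DirectSum.of_eq_of_ne _ _ _ h]
        rfl
    | add x y hx hy => simp [hx, hy]
  constructor
  · intro x y hxy
    ext n : 2
    rw [← key, ← key, hxy]
  · intro x
    refine ⟨DirectSum.of (fun n => deg q n) 0 ⟨_, degProj_mem 0 x⟩ +
      DirectSum.of (fun n => deg q n) 1 ⟨_, degProj_mem 1 x⟩ +
      DirectSum.of (fun n => deg q n) 2 ⟨_, degProj_mem 2 x⟩, ?_⟩
    rw [map_add, map_add, DirectSum.coeAddMonoidHom_of, DirectSum.coeAddMonoidHom_of,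
      DirectSum.coeAddMonoidHom_of]
    exact degProj_sum x

theorem mul_mem_deg (m n : ℕ) (x : DeRham q) (hx : x ∈ deg q m) (y : DeRham q)
    (hy : y ∈ deg q n) : x * y ∈ deg q (m + n) := by
  rcases m with _ | _ | _ | m
  · obtain ⟨h1, h2, h3⟩ := hx
    rcases n with _ | _ | _ | n
    · obtain ⟨h4, h5, h6⟩ := hy
      refine ⟨?_, ?_, ?_⟩ <;> apply Subtype.ext <;>
        simp [mul_a01, mul_a10, mul_a11, coe_mulA, *]
    · obtain ⟨h4, h5⟩ := hy
      rw [zero_add]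
      refine ⟨?_, ?_⟩ <;> apply Subtype.ext <;> simp [mul_a00, mul_a11, coe_mulA, *]
    · obtain ⟨h4, h5, h6⟩ := hy
      rw [zero_add]
      refine ⟨?_, ?_, ?_⟩ <;> apply Subtype.ext <;>
        simp [mul_a00, mul_a01, mul_a10, coe_mulA, *]
    · obtain rfl : y = 0 := hy
      simp
  · obtain ⟨h1, h2⟩ := hx
    rcases n with _ | _ | n
    · obtain ⟨h4, h5, h6⟩ := hy
      refine ⟨?_, ?_⟩ <;> apply Subtype.ext <;> simp [mul_a00, mul_a11, coe_mulA, *]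
    · obtain ⟨h4, h5⟩ := hy
      refine ⟨?_, ?_, ?_⟩ <;> apply Subtype.ext <;>
        simp [mul_a00, mul_a01, mul_a10, coe_mulA, *]
    · have h : y.a00 = 0 ∧ y.a01 = 0 ∧ y.a10 = 0 := by
        rcases n with _ | n
        · exact hy
        · obtain rfl : y = 0 := hy
          exact ⟨rfl, rfl, rfl⟩
      obtain ⟨h4, h5, h6⟩ := h
      rw [show 0 + 1 + (n + 1 + 1) = n + 3 by ring, mem_deg_add_three]
      apply ext_val <;> simp [mul_a00, mul_a01, mul_a10, mul_a11, coe_mulA, *]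
  · obtain ⟨h1, h2, h3⟩ := hx
    rcases n with _ | n
    · obtain ⟨h4, h5, h6⟩ := hy
      refine ⟨?_, ?_, ?_⟩ <;> apply Subtype.ext <;>
        simp [mul_a00, mul_a01, mul_a10, coe_mulA, *]
    · have h : y.a00 = 0 := by
        rcases n with _ | _ | n
        · exact hy.1
        · exact hy.1
        · obtain rfl : y = 0 := hy
          rfl
      rw [show 0 + 1 + 1 + (n + 1) = n + 3 by ring, mem_deg_add_three]
      apply ext_val <;> simp [mul_a00, mul_a01, mul_a10, mul_a11, coe_mulA, *]
  · obtain rfl : x = 0 := hx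
    simp

theorem d_mem_deg (n : ℕ) (x : DeRham q) (hx : x ∈ deg q n) : d x ∈ deg q (n + 1) := by
  rcases n with _ | _ | _ | n
  · obtain ⟨h1, h2, h3⟩ := hx
    refine ⟨?_, ?_⟩ <;> simp [d_a00, d_a11, *]
  · obtain ⟨h1, h2⟩ := hx
    refine ⟨?_, ?_, ?_⟩ <;> simp [d_a00, d_a01, d_a10, *]
  · obtain ⟨h1, h2, h3⟩ := hx
    rw [mem_deg_add_three (n := 0)]
    apply DeRham.ext <;> simp [d_a00, d_a01, d_a10, d_a11, *]
  · obtain rfl : x = 0 := hx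
    simp

theorem d_d (x : DeRham q) : d (d x) = 0 := by
  apply ext_val <;>
    simp [d_a00, d_a01, d_a10, d_a11, coe_delE, coe_delF, leftAct_e_f_comm]

/-- The weight scalars explain the coefficients of the product. For b in `ℬ` and a in `A q (-2)`,
q∂_e(ba) contains q·q ∂_e(b)a, matching the factor q² in the wedge. For a in `A q 2`, -q∂_f(ba)
contains -q·q⁻¹ ∂_f(b)a, matching -1. -/
theorem d_leibniz (n : ℕ) (x : DeRham q) (hx : x ∈ deg q n) (y : DeRham q) :
    d (x * y) = d x * y + (-1 : ℂ) ^ n • (x * d y) := by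
  have h0 := qc_ne q
  have e1 := fun {m n : ℤ} (x : A q m) (y : A q n) => leftAct_twisted_mul ePair_mul x.2 y.2
  have e2 := fun {m n : ℤ} (x : A q m) (y : A q n) => leftAct_twisted_mul fPair_mul x.2 y.2
  rcases n with _ | _ | _ | n
  · obtain ⟨h1, h2, h3⟩ := hx
    apply ext_val <;>
      simp [d_a00, d_a01, d_a10, d_a11, coe_delE, coe_delF, mul_a00, mul_a01, mul_a10, mul_a11,
        coe_mulA, e1, e2, zpow_neg, qh_pow_two, mul_add, h1, h2, h3]
    match_scalars <;> field_simp
  · obtain ⟨h1, h2⟩ := hx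
    apply ext_val <;>
      simp [d_a00, d_a01, d_a10, d_a11, coe_delE, coe_delF, mul_a00, mul_a01, mul_a10, mul_a11,
        coe_mulA, e1, e2, zpow_neg, qh_pow_two, add_mul, mul_add, neg_a00, neg_a01, neg_a10, neg_a11,
        h1]
    match_scalars <;> field_simp
  · obtain ⟨h1, h2, h3⟩ := hx
    apply ext_val <;>
      simp [d_a00, d_a01, d_a10, d_a11, coe_delE, coe_delF, mul_a00, mul_a01, mul_a10, mul_a11,
        coe_mulA, h1, h2, h3]
  · obtain rfl : x = 0 := hx
    simp

theorem isGradedDifferentialAlgebra (q : Set.Ioo (0 : ℝ) 1) :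
    IsGradedDifferentialAlgebra (deg q) d where
  isInternal := isInternal_deg q
  one_mem := ⟨rfl, rfl, rfl⟩
  mul_mem := mul_mem_deg
  d_mem := d_mem_deg
  d_d := d_d
  leibniz := d_leibniz

/-! ### Generation in degree zero -/

/-- The span of the forms `b₀ db₁ ⋯ dbₙ` in the explicit complex. -/
def exactSpan (q : Set.Ioo (0 : ℝ) 1) (n : ℕ) : Submodule ℂ (DeRham q) :=
  Submodule.span ℂ {w | ∃ (b₀ : A q 0) (b : Fin n → A q 0),
    w = ofB b₀ * (List.ofFn fun i => d (ofB (b i))).prod}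

theorem ofB_mem_deg (b : A q 0) : ofB b ∈ deg q 0 := ⟨rfl, rfl, rfl⟩

theorem prod_d_mem_deg (n : ℕ) (b : Fin n → A q 0) :
    (List.ofFn fun i => d (ofB (b i))).prod ∈ deg q n := by
  induction n with
  | zero => exact ⟨rfl, rfl, rfl⟩
  | succ n ih =>
    rw [List.ofFn_succ, List.prod_cons]
    have h := mul_mem_deg 1 n _ (d_mem_deg 0 _ (ofB_mem_deg (b 0))) _ (ih fun i => b i.succ)
    rwa [add_comm 1 n] at h

theorem exactSpan_le (n : ℕ) : exactSpan q n ≤ deg q n := by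
  refine Submodule.span_le.2 ?_
  rintro _ ⟨b₀, b, rfl⟩
  simpa using mul_mem_deg 0 n _ (ofB_mem_deg b₀) _ (prod_d_mem_deg n b)

end DeRham

/-! ### The fundamental corepresentation as a source of elements of `ℬ` -/

/-- The fundamental corepresentation. -/
def fundamental (q : Set.Ioo (0 : ℝ) 1) : Matrix (Fin 2) (Fin 2) (SUq q) :=
  !![gen q Gen.a, -(qc q • gen q Gen.cs); gen q Gen.c, gen q Gen.as]

/-- The inverse of the fundamental corepresentation. -/
def fundamentalInv (q : Set.Ioo (0 : ℝ) 1) : Matrix (Fin 2) (Fin 2) (SUq q) :=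
  !![gen q Gen.as, gen q Gen.cs; -(qc q • gen q Gen.c), gen q Gen.a]

theorem fundamentalInv_mul : fundamentalInv q * fundamental q = 1 := by
  ext i j
  fin_cases i <;> fin_cases j <;>
    simp [fundamental, fundamentalInv, Matrix.mul_apply, Fin.sum_univ_two, as_a, a_as, cs_c, a_c,
      cs_as, smul_smul, sq]

theorem fundamental_zero_mem (i : Fin 2) : fundamental q i 0 ∈ A q 1 := by
  fin_cases i
  · exact a_mem_A
  · exact c_mem_A

theorem fundamental_one_mem (i : Fin 2) : fundamental q i 1 ∈ A q (-1) := by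
  fin_cases i
  · exact Submodule.neg_mem _ (Submodule.smul_mem _ _ cs_mem_A)
  · exact as_mem_A

theorem fundamentalInv_zero_mem (i : Fin 2) : fundamentalInv q 0 i ∈ A q (-1) := by
  fin_cases i
  · exact as_mem_A
  · exact cs_mem_A

theorem fundamentalInv_one_mem (i : Fin 2) : fundamentalInv q 1 i ∈ A q 1 := by
  fin_cases i
  · exact Submodule.neg_mem _ (Submodule.smul_mem _ _ c_mem_A)
  · exact a_mem_A

/-- The columns of u form the two-dimensional representation: ∂_e sends column 1 to column 0 and
kills column 0. In the next lemma ∂_f does the reverse. -/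
theorem leftAct_e_fundamental (i : Fin 2) :
    leftAct (ePair q) (fundamental q i 0) = 0 ∧
      leftAct (ePair q) (fundamental q i 1) = fundamental q i 0 := by
  fin_cases i <;> simp [fundamental, leftAct_e_a, leftAct_e_c, leftAct_e_as, leftAct_e_cs,
    smul_smul, qc_ne]

theorem leftAct_f_fundamental (i : Fin 2) :
    leftAct (fPair q) (fundamental q i 1) = 0 ∧
      leftAct (fPair q) (fundamental q i 0) = fundamental q i 1 := by
  fin_cases i <;> simp [fundamental, leftAct_f_a, leftAct_f_c, leftAct_f_as, leftAct_f_cs]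

/-- The elements `u_{i0} u_{j1}` of `ℬ`, where `u` is the fundamental corepresentation. -/
def sphereGen (q : Set.Ioo (0 : ℝ) 1) (i j : Fin 2) : A q 0 :=
  ⟨fundamental q i 0 * fundamental q j 1,
    mul_mem_A (by norm_num) (fundamental_zero_mem i) (fundamental_one_mem j)⟩

theorem leftAct_e_sphereGen (i j : Fin 2) : leftAct (ePair q) (sphereGen q i j) =
    qh q • (fundamental q i 0 * fundamental q j 0) := by
  rw [sphereGen, leftAct_twisted_mul ePair_mul (fundamental_zero_mem i) (fundamental_one_mem j),
    (leftAct_e_fundamental i).1, (leftAct_e_fundamental j).2]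
  simp

theorem leftAct_f_sphereGen (i j : Fin 2) : leftAct (fPair q) (sphereGen q i j) =
    qh q • (fundamental q i 1 * fundamental q j 1) := by
  rw [sphereGen, leftAct_twisted_mul fPair_mul (fundamental_zero_mem i) (fundamental_one_mem j),
    (leftAct_f_fundamental i).2, (leftAct_f_fundamental j).1]
  simp

/-- The inner sum over i is an entry of vu = 1, hence a scalar; what is left is the same sum over j.
With r equal to the wanted column this reproduces a, and the other column gives 0. -/
theorem sum_fundamentalInv_mul (a : SUq q) (r c : Fin 2) :
    ∑ p : Fin 2 × Fin 2, a * fundamentalInv q r p.2 * fundamentalInv q r p.1 *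
      (fundamental q p.1 c * fundamental q p.2 c) = if r = c then a else 0 := by
  have h : ∑ i, fundamentalInv q r i * fundamental q i c = if r = c then 1 else 0 := by
    rw [← Matrix.mul_apply, fundamentalInv_mul, Matrix.one_apply]
  rw [Fintype.sum_prod_type_right]
  have e : ∀ j, ∑ i, a * fundamentalInv q r j * fundamentalInv q r i *
      (fundamental q i c * fundamental q j c) =
      a * fundamentalInv q r j * (if r = c then 1 else 0) * fundamental q j c := by
    intro j
    rw [← h, Finset.mul_sum, Finset.sum_mul]
    simp only [mul_assoc]
  simp only [e]
  split_ifs with hrc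
  · rw [if_pos hrc] at h
    simp only [mul_one, mul_assoc]
    rw [← Finset.mul_sum, h, mul_one]
  · simp

/-- The element `a v_{rj} v_{ri}` of `ℬ`, where `v` is the inverse of the fundamental
corepresentation. -/
def fundamentalInvMul (r : Fin 2) {m n : ℤ} (hr : ∀ i, fundamentalInv q r i ∈ A q m)
    (h : n + m + m = 0) (a : A q n) (p : Fin 2 × Fin 2) : A q 0 :=
  ⟨a * fundamentalInv q r p.2 * fundamentalInv q r p.1,
    mul_mem_A h (mul_mem_A rfl a.2 (hr _)) (hr _)⟩

/-! ### Every form is a combination of b₀ db₁ ⋯ dbₙ -/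

namespace DeRham

theorem coe_sum_a00 {ι : Type*} (s : Finset ι) (f : ι → DeRham q) :
    (((∑ i ∈ s, f i).a00 : A q 0) : SUq q) = ∑ i ∈ s, ((f i).a00 : SUq q) := by
  classical
  induction s using Finset.induction_on with
  | empty => simp
  | insert a s ha ih => simp [Finset.sum_insert ha, ih]

theorem coe_sum_a01 {ι : Type*} (s : Finset ι) (f : ι → DeRham q) :
    (((∑ i ∈ s, f i).a01 : A q (-2)) : SUq q) = ∑ i ∈ s, ((f i).a01 : SUq q) := by
  classical
  induction s using Finset.induction_on with
  | empty => simp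
  | insert a s ha ih => simp [Finset.sum_insert ha, ih]

theorem coe_sum_a10 {ι : Type*} (s : Finset ι) (f : ι → DeRham q) :
    (((∑ i ∈ s, f i).a10 : A q 2) : SUq q) = ∑ i ∈ s, ((f i).a10 : SUq q) := by
  classical
  induction s using Finset.induction_on with
  | empty => simp
  | insert a s ha ih => simp [Finset.sum_insert ha, ih]

theorem coe_sum_a11 {ι : Type*} (s : Finset ι) (f : ι → DeRham q) :
    (((∑ i ∈ s, f i).a11 : A q 0) : SUq q) = ∑ i ∈ s, ((f i).a11 : SUq q) := by
  classical
  induction s using Finset.induction_on with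
  | empty => simp
  | insert a s ha ih => simp [Finset.sum_insert ha, ih]

theorem ofB_mul_d_ofB_mem (b₀ b₁ : A q 0) : ofB b₀ * d (ofB b₁) ∈ exactSpan q 1 :=
  Submodule.subset_span ⟨b₀, fun _ => b₁, by simp⟩

theorem mul_d_ofB_mem {x : DeRham q} (hx : x ∈ exactSpan q 1) (b : A q 0) :
    x * d (ofB b) ∈ exactSpan q 2 := by
  induction hx using Submodule.span_induction with
  | mem x h =>
    obtain ⟨b₀, b₁, rfl⟩ := h
    exact Submodule.subset_span ⟨b₀, ![b₁ 0, b], by simp [mul_assoc]⟩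
  | zero => simp
  | add x y _ _ hx hy =>
    rw [add_mul]
    exact Submodule.add_mem _ hx hy
  | smul z x _ hx =>
    rw [smul_mul_assoc]
    exact Submodule.smul_mem _ _ hx

/-- Row 0 of v contracts with column 0 of u, which carries ∂_e(u_{i0}u_{j1}), and annihilates column
1, which carries the ∂_f part. The prefactor cancels the q^{1/2} produced by ∂_e. -/
theorem holomorphic_mem_exactSpan (a : A q 2) : (⟨0, 0, a, 0⟩ : DeRham q) ∈ exactSpan q 1 := by
  have h : (⟨0, 0, a, 0⟩ : DeRham q) = (qh q)⁻¹ • ∑ p : Fin 2 × Fin 2,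
      ofB (fundamentalInvMul 0 fundamentalInv_zero_mem (by norm_num) a p) *
        d (ofB (sphereGen q p.1 p.2)) := by
    apply ext_val
    · simp [coe_sum_a00, mul_a00, d_a00, coe_mulA]
    · simp only [smul_a01, Submodule.coe_smul, coe_sum_a01, mul_a01, d_a01, d_a00, ofB, coe_mulA,
        coe_delF, leftAct_f_sphereGen, fundamentalInvMul, Submodule.coe_add, mul_smul_comm,
        ZeroMemClass.coe_zero, mul_zero, add_zero]
      rw [← Finset.smul_sum, sum_fundamentalInv_mul]
      simp
    · simp only [smul_a10, Submodule.coe_smul, coe_sum_a10, mul_a10, d_a10, d_a00, ofB, coe_mulA,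
        coe_delE, leftAct_e_sphereGen, fundamentalInvMul, Submodule.coe_add, mul_smul_comm,
        ZeroMemClass.coe_zero, mul_zero, zero_add]
      rw [← Finset.smul_sum, sum_fundamentalInv_mul]
      simp [smul_smul, qh_ne]
    · simp [coe_sum_a11, mul_a11, d_a00, d_a01, d_a10, d_a11, coe_mulA, ofB]
  rw [h]
  exact Submodule.smul_mem _ _ (Submodule.sum_mem _ fun p _ => ofB_mul_d_ofB_mem _ _)

theorem antiholomorphic_mem_exactSpan (a : A q (-2)) :
    (⟨0, a, 0, 0⟩ : DeRham q) ∈ exactSpan q 1 := by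
  have h : (⟨0, a, 0, 0⟩ : DeRham q) = (qh q)⁻¹ • ∑ p : Fin 2 × Fin 2,
      ofB (fundamentalInvMul 1 fundamentalInv_one_mem (by norm_num) a p) *
        d (ofB (sphereGen q p.1 p.2)) := by
    apply ext_val
    · simp [coe_sum_a00, mul_a00, d_a00, coe_mulA]
    · simp only [smul_a01, Submodule.coe_smul, coe_sum_a01, mul_a01, d_a01, d_a00, ofB, coe_mulA,
        coe_delF, leftAct_f_sphereGen, fundamentalInvMul, Submodule.coe_add, mul_smul_comm,
        ZeroMemClass.coe_zero, mul_zero, add_zero]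
      rw [← Finset.smul_sum, sum_fundamentalInv_mul]
      simp [smul_smul, qh_ne]
    · simp only [smul_a10, Submodule.coe_smul, coe_sum_a10, mul_a10, d_a10, d_a00, ofB, coe_mulA,
        coe_delE, leftAct_e_sphereGen, fundamentalInvMul, Submodule.coe_add, mul_smul_comm,
        ZeroMemClass.coe_zero, mul_zero, zero_add]
      rw [← Finset.smul_sum, sum_fundamentalInv_mul]
      simp
    · simp [coe_sum_a11, mul_a11, d_a00, d_a01, d_a10, d_a11, coe_mulA, ofB]
  rw [h]
  exact Submodule.smul_mem _ _ (Submodule.sum_mem _ fun p _ => ofB_mul_d_ofB_mem _ _)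

/-- The element `c v_{1j} v_{1i}` of `𝒜_2`, where `v` is the inverse of the fundamental
corepresentation. -/
def volumeCoeff (c : A q 0) (p : Fin 2 × Fin 2) : A q 2 :=
  ⟨c * fundamentalInv q 1 p.2 * fundamentalInv q 1 p.1,
    mul_mem_A (by norm_num) (mul_mem_A rfl c.2 (fundamentalInv_one_mem _))
      (fundamentalInv_one_mem _)⟩

/-- A one-form with only an ω_1 part, times db, sees only ∂_f(b), with the factor q² of the wedge.
Row 1 of v then isolates c; the prefactor removes this q² and the q^{1/2} from ∂_f. -/
theorem volume_mem_exactSpan (c : A q 0) : (⟨0, 0, 0, c⟩ : DeRham q) ∈ exactSpan q 2 := by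
  have h : (⟨0, 0, 0, c⟩ : DeRham q) = (qc q ^ 2 * qh q)⁻¹ • ∑ p : Fin 2 × Fin 2,
      ⟨0, 0, volumeCoeff c p, 0⟩ * d (ofB (sphereGen q p.1 p.2)) := by
    apply ext_val
    · simp [coe_sum_a00, mul_a00, d_a00, coe_mulA]
    · simp [coe_sum_a01, mul_a01, d_a00, coe_mulA]
    · simp [coe_sum_a10, mul_a10, d_a00, coe_mulA]
    · simp only [smul_a11, Submodule.coe_smul, coe_sum_a11, mul_a11, d_a01, d_a00, ofB, coe_mulA,
        coe_delF, leftAct_f_sphereGen, volumeCoeff, Submodule.coe_add, Submodule.coe_sub,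
        mul_smul_comm, ZeroMemClass.coe_zero, mul_zero, zero_mul, zero_add, add_zero, sub_zero,
        smul_smul]
      rw [← Finset.smul_sum, sum_fundamentalInv_mul, if_pos rfl, smul_smul,
        inv_mul_cancel₀ (mul_ne_zero (pow_ne_zero 2 (qc_ne q)) (qh_ne q)), one_smul]
  rw [h]
  exact Submodule.smul_mem _ _
    (Submodule.sum_mem _ fun p _ => mul_d_ofB_mem (holomorphic_mem_exactSpan _) _)

theorem exactSpan_eq (n : ℕ) : exactSpan q n = deg q n := by
  refine le_antisymm (exactSpan_le n) ?_
  intro x hx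
  rcases n with _ | _ | _ | n
  · obtain ⟨h1, h2, h3⟩ := hx
    refine Submodule.subset_span ⟨x.a00, fun i => i.elim0, ?_⟩
    simp only [List.ofFn_zero, List.prod_nil, mul_one]
    exact DeRham.ext rfl h1 h2 h3
  · obtain ⟨h1, h2⟩ := hx
    have h : x = ⟨0, x.a01, 0, 0⟩ + ⟨0, 0, x.a10, 0⟩ := by
      apply DeRham.ext <;> simp [h1, h2]
    rw [h]
    exact Submodule.add_mem _ (antiholomorphic_mem_exactSpan _) (holomorphic_mem_exactSpan _)
  · obtain ⟨h1, h2, h3⟩ := hx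
    have h : x = ⟨0, 0, 0, x.a11⟩ := DeRham.ext h1 h2 h3 rfl
    rw [h]
    exact volume_mem_exactSpan _
  · obtain rfl : x = 0 := hx
    exact Submodule.zero_mem _

theorem iSup_deg (q : Set.Ioo (0 : ℝ) 1) : ⨆ n, deg q n = ⊤ :=
  (isInternal_deg q).submodule_iSup_eq_top

/-- An algebra homomorphism on the complex is determined by its values on `ℬ` and `dℬ`. -/
theorem algHom_ext {R : Type*} [Ring R] [Algebra ℂ R] {f g : DeRham q →ₐ[ℂ] R}
    (h₀ : ∀ b : A q 0, f (ofB b) = g (ofB b))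
    (h₁ : ∀ b : A q 0, f (d (ofB b)) = g (d (ofB b))) : f = g := by
  have key : (⊤ : Submodule ℂ (DeRham q)) ≤ (AlgHom.equalizer f g).toSubmodule := by
    rw [← iSup_deg]
    refine iSup_le fun n => ?_
    rw [← exactSpan_eq]
    refine Submodule.span_le.2 ?_
    rintro _ ⟨b₀, b, rfl⟩
    refine Subalgebra.mul_mem _ (h₀ b₀) (Subalgebra.list_prod_mem _ ?_)
    intro x hx
    obtain ⟨i, rfl⟩ := (List.mem_ofFn' _ _).1 hx
    exact h₁ (b i)
  ext x
  exact key (Submodule.mem_top (x := x))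

/-! ### The extension of the twist -/

/-- The action `a ↦ a ◁ k^n` on all components. -/
def twistHom (q : Set.Ioo (0 : ℝ) 1) (n : ℤ) : DeRham q →ₐ[ℂ] DeRham q :=
  AlgHom.ofLinearMap
    { toFun x :=
        ⟨⟨rightAct (kPow q n) x.a00, rightAct_mem_A _ x.a00.2⟩,
          ⟨rightAct (kPow q n) x.a01, rightAct_mem_A _ x.a01.2⟩,
          ⟨rightAct (kPow q n) x.a10, rightAct_mem_A _ x.a10.2⟩,
          ⟨rightAct (kPow q n) x.a11, rightAct_mem_A _ x.a11.2⟩⟩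
      map_add' x y := by apply ext_val <;> simp
      map_smul' z x := by apply ext_val <;> simp }
    (by apply ext_val <;> simp [one_a00, one_a01, one_a10, one_a11, rightAct_kPow_one])
    (fun x y => by
      apply ext_val <;>
        simp [mul_a00, mul_a01, mul_a10, mul_a11, coe_mulA, rightAct_kPow_mul])

section
variable (n : ℤ) (x : DeRham q)

theorem coe_twistHom_a00 : ((twistHom q n x).a00 : SUq q) = rightAct (kPow q n) x.a00 := rfl
theorem coe_twistHom_a01 : ((twistHom q n x).a01 : SUq q) = rightAct (kPow q n) x.a01 := rfl
theorem coe_twistHom_a10 : ((twistHom q n x).a10 : SUq q) = rightAct (kPow q n) x.a10 := rfl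
theorem coe_twistHom_a11 : ((twistHom q n x).a11 : SUq q) = rightAct (kPow q n) x.a11 := rfl

end

theorem twistHom_twistHom {m n : ℤ} (h : m + n = 0) (x : DeRham q) :
    twistHom q m (twistHom q n x) = x := by
  apply ext_val <;>
    simp only [coe_twistHom_a00, coe_twistHom_a01, coe_twistHom_a10, coe_twistHom_a11,
      ← rightAct_kPow_add, h, rightAct_kPow_zero]

/-- The extension of the twist to the complex. -/
def twistEquiv (q : Set.Ioo (0 : ℝ) 1) : DeRham q ≃ₐ[ℂ] DeRham q :=
  AlgEquiv.ofAlgHom (twistHom q 2) (twistHom q (-2))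
    (AlgHom.ext fun x => (AlgHom.comp_apply _ _ x).trans (twistHom_twistHom (add_neg_cancel 2) x))
    (AlgHom.ext fun x => (AlgHom.comp_apply _ _ x).trans (twistHom_twistHom (neg_add_cancel 2) x))

theorem twistEquiv_apply (x : DeRham q) : twistEquiv q x = twistHom q 2 x := rfl

theorem twistEquiv_ofB (b : A q 0) : twistEquiv q (ofB b) = ofB (twist q b) := by
  rw [twistEquiv_apply]
  apply ext_val <;>
    simp [coe_twistHom_a00, coe_twistHom_a01, coe_twistHom_a10, coe_twistHom_a11, ofB, coe_twist]

theorem twistEquiv_d (x : DeRham q) : twistEquiv q (d x) = d (twistEquiv q x) := by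
  rw [twistEquiv_apply, twistEquiv_apply]
  apply ext_val <;>
    simp [coe_twistHom_a00, coe_twistHom_a01, coe_twistHom_a10, coe_twistHom_a11, d_a00, d_a01,
      d_a10, d_a11, coe_delE, coe_delF, leftAct_rightAct]

/-- Commutation with d fixes the values on d`ℬ`, and `ℬ` together with d`ℬ` generates the complex.
-/
theorem twistEquiv_unique (σ : DeRham q ≃ₐ[ℂ] DeRham q)
    (h₀ : ∀ b : A q 0, σ (ofB b) = ofB (twist q b)) (h₁ : ∀ x, σ (d x) = d (σ x)) :
    σ = twistEquiv q := by
  have h : (σ : DeRham q →ₐ[ℂ] DeRham q) = twistEquiv q := by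
    refine algHom_ext (fun b => ?_) (fun b => ?_)
    · exact (h₀ b).trans (twistEquiv_ofB b).symm
    · change σ _ = twistEquiv q _
      rw [h₁, twistEquiv_d, h₀, twistEquiv_ofB]
  ext1 x
  exact DFunLike.congr_fun h x

theorem twistEquiv_mem_deg (n : ℕ) (x : DeRham q) (hx : x ∈ deg q n) :
    twistEquiv q x ∈ deg q n := by
  rw [twistEquiv_apply]
  rcases n with _ | _ | _ | n
  · obtain ⟨h1, h2, h3⟩ := hx
    refine ⟨?_, ?_, ?_⟩ <;> apply Subtype.ext <;>
      simp [coe_twistHom_a01, coe_twistHom_a10, coe_twistHom_a11, *]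
  · obtain ⟨h1, h2⟩ := hx
    refine ⟨?_, ?_⟩ <;> apply Subtype.ext <;> simp [coe_twistHom_a00, coe_twistHom_a11, *]
  · obtain ⟨h1, h2, h3⟩ := hx
    refine ⟨?_, ?_, ?_⟩ <;> apply Subtype.ext <;>
      simp [coe_twistHom_a00, coe_twistHom_a01, coe_twistHom_a10, *]
  · obtain rfl : x = 0 := hx
    simp

/-! ### The integral -/

theorem integral_d (x : DeRham q) : integral (haar q) (d x) = 0 := by
  simp [integral, d_a11, coe_delE, coe_delF, haar_leftAct_e, haar_leftAct_f]

theorem integral_mul (m n : ℕ) (hmn : m + n = 2) (x : DeRham q) (hx : x ∈ deg q m)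
    (y : DeRham q) (hy : y ∈ deg q n) :
    integral (haar q) (x * y) = (-1) ^ (m * n) * integral (haar q) (twistEquiv q y * x) := by
  have e := fun {m n : ℤ} (x : A q m) (y : A q n) => haar_mul_comm_of_mem_A (x : SUq q) y.2
  have h0 := qc_ne q
  simp only [integral, twistEquiv_apply, mul_a11, Submodule.coe_add, Submodule.coe_sub,
    Submodule.coe_smul, coe_mulA, coe_twistHom_a00, coe_twistHom_a01, coe_twistHom_a10,
    coe_twistHom_a11, map_add, map_sub, map_smul, e, smul_eq_mul]
  obtain ⟨rfl, rfl⟩ | ⟨rfl, rfl⟩ | ⟨rfl, rfl⟩ :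
      (m = 0 ∧ n = 2) ∨ (m = 1 ∧ n = 1) ∨ (m = 2 ∧ n = 0) := by omega
  · obtain ⟨h1, h2, h3⟩ := hx
    obtain ⟨h4, h5, h6⟩ := hy
    simp [*]
  -- The modular scalars q² on `A q 2` and q⁻² on `A q (-2)` interchange the wedge coefficients -1
  -- and q² up to the sign -1.
  · obtain ⟨h1, h2⟩ := hx
    obtain ⟨h3, h4⟩ := hy
    simp [*]
  · obtain ⟨h1, h2, h3⟩ := hx
    obtain ⟨h4, h5, h6⟩ := hy
    simp [*]

end DeRham

/-! ### Products of forms with homogeneous coefficients -/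

namespace Forms

theorem single_add (S : Finset (Fin 3)) (a b : SUq q) :
    single S (a + b) = single S a + single S b :=
  Pi.single_add (f := fun _ => SUq q) S a b

theorem single_smul (S : Finset (Fin 3)) (z : ℂ) (a : SUq q) :
    single S (z • a) = z • single S a :=
  Pi.single_smul (f := fun _ => SUq q) S z a

theorem single_neg (S : Finset (Fin 3)) (a : SUq q) : single S (-a) = -single S a :=
  Pi.single_neg (f := fun _ => SUq q) S a

theorem single_zero (S : Finset (Fin 3)) : single S (0 : SUq q) = 0 := Pi.single_zero S

theorem single_apply (S T : Finset (Fin 3)) (a : SUq q) :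
    single S a T = if T = S then a else 0 :=
  Pi.single_apply S a T

theorem ofA_mul_single (a b : SUq q) (S : Finset (Fin 3)) :
    ofA a * single S b = single S (a * b) := by
  unfold ofA
  rw [single_mul_single, if_pos (Finset.disjoint_empty_left S)]
  simp [reorder, formWeight, leftAct_kPow_zero]

theorem single_mul_single_of_mem_A {S T : Finset (Fin 3)} (h : Disjoint S T) (a : SUq q) {n : ℤ}
    {b : SUq q} (hb : b ∈ A q n) : single S a * single T b =
      (reorder q S T * qh q ^ (-formWeight S * n)) • single (S ∪ T) (a * b) := by
  rw [single_mul_single, if_pos h, leftAct_kPow_of_mem hb, mul_smul_comm, smul_smul, single_smul]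

theorem single_mul_single_of_not_disjoint {S T : Finset (Fin 3)} (h : ¬ Disjoint S T)
    (a b : SUq q) : single S a * single T b = 0 := by
  rw [single_mul_single, if_neg h]

theorem single_mul_ofA {S : Finset (Fin 3)} (a : SUq q) {b : SUq q} (hb : b ∈ A q 0) :
    single S a * ofA b = single S (a * b) := by
  unfold ofA
  rw [single_mul_single_of_mem_A (Finset.disjoint_empty_right S) a hb]
  simp [reorder]

theorem single_mul_omegaSet {S T : Finset (Fin 3)} (h : Disjoint S T) (a : SUq q) :
    single S a * omegaSet q T = reorder q S T • single (S ∪ T) a := by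
  unfold omegaSet
  rw [single_mul_single_of_mem_A h a one_mem_A]
  simp

theorem single_mul_omegaSet_of_not_disjoint {S T : Finset (Fin 3)} (h : ¬ Disjoint S T)
    (a : SUq q) : single S a * omegaSet q T = 0 :=
  single_mul_single_of_not_disjoint h a 1

/-! ### The embedding of the explicit complex -/

/-- The map `(a₀₀, a₀₁, a₁₀, a₁₁) ↦ a₀₀ + a₀₁ ω_{-1} + a₁₀ ω_1 + a₁₁ ω_1 ω_{-1}`. -/
def embedLinear (q : Set.Ioo (0 : ℝ) 1) : DeRham q →ₗ[ℂ] Forms q where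
  toFun x := ofA (x.a00 : SUq q) + (single {2} (x.a01 : SUq q) + single {0} (x.a10 : SUq q)) +
    single {0, 2} (x.a11 : SUq q)
  map_add' x y := by
    simp only [DeRham.add_a00, DeRham.add_a01, DeRham.add_a10, DeRham.add_a11, Submodule.coe_add,
      ofA, single_add]
    abel
  map_smul' z x := by
    simp only [DeRham.smul_a00, DeRham.smul_a01, DeRham.smul_a10, DeRham.smul_a11,
      Submodule.coe_smul, ofA, single_smul, smul_add, RingHom.id_apply]

theorem embedLinear_apply (x : DeRham q) : embedLinear q x =
    ofA (x.a00 : SUq q) + (single {2} (x.a01 : SUq q) + single {0} (x.a10 : SUq q)) +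
      single {0, 2} (x.a11 : SUq q) := rfl

/-- The forms ω_1, ω_{-1} are already in order; the factor comes only from moving ω_1 past a
coefficient of weight -2. -/
theorem single_zero_mul_single_two (a : SUq q) {b : SUq q} (hb : b ∈ A q (-2)) :
    single {0} a * single {2} b = qc q ^ 2 • single {0, 2} (a * b) := by
  rw [single_mul_single_of_mem_A (by decide) a hb, ← qh_pow_four,
    show ({0} ∪ {2} : Finset (Fin 3)) = {0, 2} by decide]
  congr 1
  simp [reorder, swapCoeff, formWeight]

/-- Moving ω_{-1} past weight 2 gives q⁻² and reordering gives -q², so only the sign survives. -/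
theorem single_two_mul_single_zero (a : SUq q) {b : SUq q} (hb : b ∈ A q 2) :
    single {2} a * single {0} b = -single {0, 2} (a * b) := by
  rw [single_mul_single_of_mem_A (by decide) a hb,
    show ({2} ∪ {0} : Finset (Fin 3)) = {0, 2} by decide, ← neg_one_smul ℂ (single _ _)]
  congr 1
  have h : qh q ^ (-4 : ℤ) = (qc q ^ 2)⁻¹ := by
    rw [← qh_pow_four, zpow_neg]
    rfl
  simp [reorder, swapCoeff, formWeight, h, qc_ne]

theorem embedLinear_one (q : Set.Ioo (0 : ℝ) 1) : embedLinear q 1 = 1 := by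
  rw [embedLinear_apply, DeRham.one_a00, DeRham.one_a01, DeRham.one_a10, DeRham.one_a11]
  simp only [ZeroMemClass.coe_zero, single_zero, add_zero]
  rfl

theorem embedLinear_mul (x y : DeRham q) :
    embedLinear q (x * y) = embedLinear q x * embedLinear q y := by
  have n1 : ∀ a b : SUq q, single {2} a * single {2} b = 0 :=
    single_mul_single_of_not_disjoint (by decide)
  have n2 : ∀ a b : SUq q, single {0} a * single {0} b = 0 :=
    single_mul_single_of_not_disjoint (by decide)
  have n3 : ∀ a b : SUq q, single {2} a * single {0, 2} b = 0 :=
    single_mul_single_of_not_disjoint (by decide)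
  have n4 : ∀ a b : SUq q, single {0} a * single {0, 2} b = 0 :=
    single_mul_single_of_not_disjoint (by decide)
  have n5 : ∀ a b : SUq q, single {0, 2} a * single {2} b = 0 :=
    single_mul_single_of_not_disjoint (by decide)
  have n6 : ∀ a b : SUq q, single {0, 2} a * single {0} b = 0 :=
    single_mul_single_of_not_disjoint (by decide)
  have n7 : ∀ a b : SUq q, single {0, 2} a * single {0, 2} b = 0 :=
    single_mul_single_of_not_disjoint (by decide)
  have m : ∀ (S : Finset (Fin 3)) (a : SUq q), single S a * ofA (y.a00 : SUq q) =
      single S (a * (y.a00 : SUq q)) := fun S a => single_mul_ofA a y.a00.2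
  have m0 : ∀ a b : SUq q, ofA (a * b) = ofA a * ofA b := fun a b => (ofA_mul_single a b ∅).symm
  simp only [embedLinear_apply, DeRham.mul_a00, DeRham.mul_a01, DeRham.mul_a10, DeRham.mul_a11,
    Submodule.coe_add, Submodule.coe_smul, coe_mulA, mul_add, add_mul, n1, n2,
    n3, n4, n5, n6, n7, m, m0, ofA_mul_single, single_zero_mul_single_two _ y.a01.2,
    single_two_mul_single_zero _ y.a10.2, sub_eq_add_neg, Submodule.coe_neg, single_add, single_neg, single_smul]
  abel

/-- The embedding of the explicit complex into the exterior algebra, as a homomorphism. -/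
def embed (q : Set.Ioo (0 : ℝ) 1) : DeRham q →ₐ[ℂ] Forms q :=
  AlgHom.ofLinearMap (embedLinear q) (embedLinear_one q) embedLinear_mul

theorem embed_apply (x : DeRham q) : embed q x =
    ofA (x.a00 : SUq q) + (single {2} (x.a01 : SUq q) + single {0} (x.a10 : SUq q)) +
      single {0, 2} (x.a11 : SUq q) := rfl

theorem embed_apply_omega (x : DeRham q) : embed q x =
    ofA (x.a00 : SUq q) +
      (ofA (x.a01 : SUq q) * omega q 2 + ofA (x.a10 : SUq q) * omega q 0) +
      ofA (x.a11 : SUq q) * (omega q 0 * omega q 2) := by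
  rw [(omega_mul_omega (by decide)).1, ofA_mul_omega]
  unfold omega
  rw [ofA_mul_single, ofA_mul_single, mul_one, mul_one]
  rfl

theorem embed_injective (q : Set.Ioo (0 : ℝ) 1) : Function.Injective (embed q) := by
  intro x y h
  have e : ∀ S, embed q x S = embed q y S := fun S => congrFun h S
  have e0 := e ∅
  have e1 := e {2}
  have e2 := e {0}
  have e3 := e {0, 2}
  simp only [embed_apply, add_apply, ofA, single_apply] at e0 e1 e2 e3
  apply DeRham.ext_val
  · simpa [show (∅ : Finset (Fin 3)) ≠ {0, 2} by decide] using e0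
  · simpa [show ({2} : Finset (Fin 3)) ≠ {0, 2} by decide] using e1
  · simpa [show ({0} : Finset (Fin 3)) ≠ {0, 2} by decide] using e2
  · simpa [show ({0, 2} : Finset (Fin 3)) ≠ {2} by decide,
      show ({0, 2} : Finset (Fin 3)) ≠ {0} by decide] using e3

/-! ### The differential -/

theorem d0_of_mem {n : ℤ} {a : SUq q} (ha : a ∈ A q n) : d0 a =
    qh q ^ (-n) • single {2} (leftAct (fPair q) a) +
      ((1 - (qc q ^ 2)⁻¹)⁻¹ * (1 - qh q ^ (-4 * n))) • single {1} a +
      qh q ^ (-n) • single {0} (leftAct (ePair q) a) := by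
  unfold d0 omega
  simp only [leftAct_conv, leftAct_kPow_of_mem ha, map_smul, ofA_mul_single, mul_one, single_smul]
  rw [← one_smul ℂ a, smul_smul, ← sub_smul, single_smul, smul_smul]
  simp

theorem d0_zero : d0 (0 : SUq q) = 0 := by
  rw [d0_of_mem (n := 0) (Submodule.zero_mem _)]
  simp [single_zero]

theorem d_single (S : Finset (Fin 3)) (a : SUq q) :
    d (single S a) = d0 a * omegaSet q S + ofA a * dOmega q S := by
  unfold d
  rw [Finset.sum_eq_single S]
  · rw [single_apply, if_pos rfl]
  · intro T _ hT
    rw [single_apply, if_neg hT, d0_zero]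
    simp [ofA, single_zero]
  · simp

theorem d0_add (a b : SUq q) : d0 (a + b) = d0 a + d0 b := by
  simp only [d0, map_add, ofA, single_add, add_sub_add_comm, smul_add, add_mul]
  abel

theorem d_add (x y : Forms q) : d (x + y) = d x + d y := by
  unfold d
  rw [← Finset.sum_add_distrib]
  refine Finset.sum_congr rfl fun S _ => ?_
  rw [add_apply, d0_add, ofA, single_add]
  simp only [ofA, add_mul]
  abel

theorem d_ofA {b : SUq q} (hb : b ∈ A q 0) : d (ofA b) =
    single {2} (leftAct (fPair q) b) + single {0} (leftAct (ePair q) b) := by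
  unfold ofA
  rw [d_single, d0_of_mem hb, show omegaSet q ∅ = 1 from rfl]
  simp [dOmega]

theorem d_single_two {a : SUq q} (ha : a ∈ A q (-2)) :
    d (single {2} a) = qc q • single {0, 2} (leftAct (ePair q) a) := by
  have h1 := one_sub_qc_pow_ne_zero q two_ne_zero
  have h0 := qc_ne q
  have h8 : qh q ^ 8 = qc q ^ 4 := by
    rw [← qh_sq]
    ring
  -- The ω_0-coefficient of da at weight -2 is the negative of the constant in dω_{-1}, so the
  -- ω_0ω_{-1} terms cancel.
  have hz : (1 - (qc q ^ 2)⁻¹)⁻¹ * (1 - qh q ^ (-4 * -2 : ℤ)) = -(qc q ^ 2 + qc q ^ 4) := by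
    rw [show (-4 * -2 : ℤ) = (8 : ℕ) by norm_num, zpow_natCast, h8]
    have h2 : (qc q ^ 2 - 1) ≠ 0 := by
      intro h
      exact h1 (by linear_combination -h)
    field_simp
    ring
  have hw : omega q 1 * omega q 2 = single {1, 2} 1 := (omega_mul_omega (by decide)).1
  rw [d_single, d0_of_mem ha, hz, add_mul, add_mul, smul_mul_assoc, smul_mul_assoc, smul_mul_assoc,
    single_mul_omegaSet_of_not_disjoint (by decide), single_mul_omegaSet (by decide),
    single_mul_omegaSet (by decide), show ({1} ∪ {2} : Finset (Fin 3)) = {1, 2} by decide,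
    show ({0} ∪ {2} : Finset (Fin 3)) = {0, 2} by decide, dOmega, if_pos rfl, mul_smul_comm, hw,
    ofA_mul_single, mul_one, neg_neg, zpow_ofNat, qh_pow_two]
  simp [reorder, swapCoeff]
  module

theorem d_single_zero {a : SUq q} (ha : a ∈ A q 2) :
    d (single {0} a) = -(qc q • single {0, 2} (leftAct (fPair q) a)) := by
  have h1 := one_sub_qc_pow_ne_zero q two_ne_zero
  have h0 := qc_ne q
  have h8 : qh q ^ 8 = qc q ^ 4 := by
    rw [← qh_sq]
    ring
  -- At weight 2 the cancellation against dω_1 also needs the factor -q⁴ from reordering ω_0ω_1.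
  have hz : (1 - (qc q ^ 2)⁻¹)⁻¹ * (1 - qh q ^ (-4 * 2 : ℤ)) * -qc q ^ 4 =
      -(qc q ^ 2 + qc q ^ 4) := by
    rw [show (-4 * 2 : ℤ) = -((8 : ℕ) : ℤ) by norm_num, zpow_neg, zpow_natCast, h8]
    have h2 : (qc q ^ 2 - 1) ≠ 0 := by
      intro h
      exact h1 (by linear_combination -h)
    field_simp
    ring
  have hw : omega q 0 * omega q 1 = single {0, 1} 1 := (omega_mul_omega (by decide)).1
  have r1 : reorder q {1} {0} = -qc q ^ 4 := by simp [reorder, swapCoeff]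
  have r2 : reorder q {2} {0} = -qc q ^ 2 := by simp [reorder, swapCoeff]
  rw [d_single, d0_of_mem ha, add_mul, add_mul, smul_mul_assoc, smul_mul_assoc, smul_mul_assoc,
    single_mul_omegaSet_of_not_disjoint (S := {0}) (by decide), single_mul_omegaSet (by decide),
    single_mul_omegaSet (by decide), show ({1} ∪ {0} : Finset (Fin 3)) = {0, 1} by decide,
    show ({2} ∪ {0} : Finset (Fin 3)) = {0, 2} by decide, dOmega, if_neg (by decide),
    if_neg (by decide), if_pos rfl, mul_smul_comm, hw, ofA_mul_single, mul_one, zpow_neg,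
    zpow_ofNat, qh_pow_two, smul_smul, smul_smul, r1, r2, hz]
  match_scalars <;> field_simp
  ring

/-- The ω_{±1} parts of dc repeat a form already present, and the ω_0 part vanishes at weight 0. -/
theorem d_single_zero_two {c : SUq q} (hc : c ∈ A q 0) : d (single {0, 2} c) = 0 := by
  rw [d_single, d0_of_mem hc, add_mul, add_mul, smul_mul_assoc, smul_mul_assoc, smul_mul_assoc,
    single_mul_omegaSet_of_not_disjoint (S := {2}) (by decide),
    single_mul_omegaSet_of_not_disjoint (S := {0}) (by decide), dOmega, if_neg (by decide),
    if_neg (by decide), if_neg (by decide)]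
  simp

theorem embed_d (x : DeRham q) : embed q (DeRham.d x) = d (embed q x) := by
  rw [embed_apply, embed_apply, d_add, d_add, d_add, d_ofA x.a00.2, d_single_two x.a01.2,
    d_single_zero x.a10.2, d_single_zero_two x.a11.2]
  simp only [DeRham.d_a00, DeRham.d_a01, DeRham.d_a10, DeRham.d_a11, coe_delE, coe_delF,
    ZeroMemClass.coe_zero, Submodule.coe_add, Submodule.coe_neg, Submodule.coe_smul, single_add,
    single_neg, single_smul, ofA, single_zero]
  abel

/-! ### The de Rham complex of the sphere -/

theorem embed_ofB (b : A q 0) : embed q (DeRham.ofB b) = ofA (b : SUq q) := by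
  rw [embed_apply]
  simp [DeRham.ofB, single_zero]

/-- As `embed` is multiplicative and commutes with d, it carries the spanning forms b₀ db₁ ⋯ dbₙ of
`exactSpan` to those of the sphere; `exactSpan_eq` does the rest. -/
theorem map_deg (n : ℕ) :
    (DeRham.deg q n).map (embed q).toLinearMap = sphereForms q n := by
  have h : ∀ (b₀ : A q 0) (b : Fin n → A q 0),
      embed q (DeRham.ofB b₀ * (List.ofFn fun i => DeRham.d (DeRham.ofB (b i))).prod) =
        ofA (b₀ : SUq q) * (List.ofFn fun i => d (ofA (b i : SUq q))).prod := by
    intro b₀ b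
    rw [map_mul, map_list_prod, List.map_ofFn, embed_ofB]
    congr 3
    funext i
    rw [Function.comp_apply, embed_d, embed_ofB]
  rw [← DeRham.exactSpan_eq, DeRham.exactSpan, sphereForms, Submodule.map_span]
  congr 1
  ext w
  constructor
  · rintro ⟨_, ⟨b₀, b, rfl⟩, rfl⟩
    exact ⟨b₀, b₀.2, fun i => b i, fun i => (b i).2, h b₀ b⟩
  · rintro ⟨b₀, hb₀, b, hb, rfl⟩
    exact ⟨_, ⟨⟨b₀, hb₀⟩, fun i => ⟨b i, hb i⟩, rfl⟩, h ⟨b₀, hb₀⟩ fun i => ⟨b i, hb i⟩⟩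

theorem range_embed (q : Set.Ioo (0 : ℝ) 1) :
    LinearMap.range (embed q).toLinearMap = ⨆ n : ℕ, sphereForms q n := by
  rw [LinearMap.range_eq_map, ← DeRham.iSup_deg, Submodule.map_iSup]
  exact iSup_congr map_deg

end Forms

end

end QSphere

theorem theorem2p1 (q : Set.Ioo (0 : ℝ) 1) :
    -- the de Rham complex of the sphere is the explicit graded differential algebra
    (IsGradedDifferentialAlgebra (DeRham.deg q) DeRham.d ∧
      ∃ Φ : DeRham q →ₐ[ℂ] Forms q,
        (∀ x : DeRham q, Φ x = Forms.ofA (x.a00 : SUq q) +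
          (Forms.ofA (x.a01 : SUq q) * Forms.omega q 2 +
            Forms.ofA (x.a10 : SUq q) * Forms.omega q 0) +
          Forms.ofA (x.a11 : SUq q) * (Forms.omega q 0 * Forms.omega q 2)) ∧
        Function.Injective Φ ∧
        (∀ n : ℕ, (DeRham.deg q n).map Φ.toLinearMap = Forms.sphereForms q n) ∧
        LinearMap.range Φ.toLinearMap = ⨆ n : ℕ, Forms.sphereForms q n ∧
        (∀ x : DeRham q, Φ (DeRham.d x) = Forms.d (Φ x))) ∧
    -- the Haar state exists and is unique
    ∃ h : Module.Dual ℂ (SUq q), IsHaarState h ∧ (∀ h', IsHaarState h' → h' = h) ∧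
      -- the integral is closed
      (∀ ω ∈ DeRham.deg q 1, DeRham.integral h (DeRham.d ω) = 0) ∧
      -- the twist extends uniquely, and the integral is a twisted graded trace
      ∃ σ : DeRham q ≃ₐ[ℂ] DeRham q,
        ((∀ b : A q 0, σ (DeRham.ofB b) = DeRham.ofB (twist q b)) ∧
          ∀ x, σ (DeRham.d x) = DeRham.d (σ x)) ∧
        (∀ σ' : DeRham q ≃ₐ[ℂ] DeRham q,
          ((∀ b : A q 0, σ' (DeRham.ofB b) = DeRham.ofB (twist q b)) ∧
            ∀ x, σ' (DeRham.d x) = DeRham.d (σ' x)) → σ' = σ) ∧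
        (∀ n : ℕ, ∀ x ∈ DeRham.deg q n, σ x ∈ DeRham.deg q n) ∧
        ∀ m n : ℕ, m + n = 2 → ∀ ω ∈ DeRham.deg q m, ∀ ω' ∈ DeRham.deg q n,
          DeRham.integral h (ω * ω') = (-1) ^ (m * n) * DeRham.integral h (σ ω' * ω) := by
  refine ⟨⟨DeRham.isGradedDifferentialAlgebra q, Forms.embed q, Forms.embed_apply_omega,
    Forms.embed_injective q, Forms.map_deg, Forms.range_embed q, Forms.embed_d⟩,
    haar q, isHaarState_haar q, fun h' hh' => ?_, fun ω _ => DeRham.integral_d ω,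
    DeRham.twistEquiv q, ⟨DeRham.twistEquiv_ofB, DeRham.twistEquiv_d⟩,
    fun σ' h => DeRham.twistEquiv_unique σ' h.1 h.2, DeRham.twistEquiv_mem_deg,
    DeRham.integral_mul⟩
  exact invariant_unique hh'.map_one (haar_one q) hh'.left_invariant
    (isHaarState_haar q).right_invariant
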